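/- Let $n\ge 0$ and $m\ge 1$ be integers, let $e_1,\dots,e_n$ be the standard basis of $\mathbb{C}^n$, and let $N:\mathbb{C}^n\to\mathbb{C}^n$ be the nilpotent operator with $N(e_i)=e_{i+m}$ if $i+m\le n$ and $N(e_i)=0$ otherwise. Let $\mathrm{Fl}(\mathbb{C}^n)$ be the variety of complete flags $\mathbf{F}=\{\mathbb{C}^n=V_1\supset V_2\supset\dots\supset V_n\}$, $\dim V_i=n-i+1$, and let $$X_N=\{\mathbf{F}\in \mathrm{Fl}(\mathbb{C}^n) : N(V_i)\subset V_i \text{ for all } i\}$$ be the Springer fiber of $N$. A permutation $\omega\in S_n$ is called $m$-restricted if $\omega^{-1}(x+m)>\omega^{-1}(x)$ for all $1\le x\le n-m$. For $\omega\in S_n$ let $C_\omega\subset\mathrm{Fl}(\mathbb{C}^n)$ be the Schubert cell of all flags with $V_i=\mathrm{span}\{v^{\omega(i)},\dots,v^{\omega(n)}\}$ for all $i$, for some vectors of the form $v^{\alpha}=e_\alpha+\sum_{\beta>\alpha}\lambda^\alpha_\beta e_\beta$, and put $\Sigma_\omega=C_\omega\cap X_N$. Then $X_N$ is a closed subvariety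 of $\mathrm{Fl}(\mathbb{C}^n)$, and the sets $\Sigma_\omega$, where $\omega$ runs over the $m$-restricted permutations in $S_n$, form an affine paving of $X_N$: they are locally closed, they are pairwise disjoint with union $X_N$, they can be ordered so that the union of the first $k$ of them is closed in $X_N$ for every $k$, and each $\Sigma_\omega$ (with its structure of a reduced subvariety) is isomorphic to an affine space $\mathbb{C}^{d(\omega)}$. Its dimension $d(\omega)$ is the number of inversions of $\omega^{-1}$ of height less than $m$, that is, the number of pairs $1\le\alpha<\beta\le n$ with $\omega^{-1}(\alpha)>\omega^{-1}(\beta)$ and $\beta-\alpha<m$. -/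

import Mathlib

open scoped Topology

/-- A space with functions over `ℂ`: a topological space with a sheaf of `ℂ`-algebras of
`ℂ`-valued functions. `IsRegular U f` means that the restriction of `f` to the open set `U` is a
section; the values of `f` off `U` are irrelevant by `congr`.
This is the classical language of complex algebraic varieties, identified with their closed points. -/
structure SpaceWithFunctions (X : Type) where
  top : TopologicalSpace X
  IsRegular : Set X → (X → ℂ) → Prop
  congr : ∀ {U : Set X} {f g : X → ℂ}, IsOpen[top] U → Set.EqOn f g U →
    IsRegular U f → IsRegular U g
  mono : ∀ {U W : Set X} {f : X → ℂ}, IsOpen[top] U → IsOpen[top] W → W ⊆ U →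
    IsRegular U f → IsRegular W f
  glue : ∀ {U : Set X} {f : X → ℂ}, IsOpen[top] U →
    (∀ x ∈ U, ∃ W, IsOpen[top] W ∧ x ∈ W ∧ W ⊆ U ∧ IsRegular W f) → IsRegular U f
  const : ∀ {U : Set X} (c : ℂ), IsOpen[top] U → IsRegular U (fun _ => c)
  add : ∀ {U : Set X} {f g : X → ℂ}, IsOpen[top] U → IsRegular U f → IsRegular U g →
    IsRegular U (fun x => f x + g x)
  mul : ∀ {U : Set X} {f g : X → ℂ}, IsOpen[top] U → IsRegular U f → IsRegular U g →
    IsRegular U (fun x => f x * g x)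

namespace SpaceWithFunctions

/-- Morphisms: continuous maps that pull regular functions back to regular functions. -/
def IsMorphism {X Y : Type} (S : SpaceWithFunctions X) (T : SpaceWithFunctions Y)
    (φ : X → Y) : Prop :=
  (∀ U : Set Y, IsOpen[T.top] U → IsOpen[S.top] (φ ⁻¹' U)) ∧
  ∀ (U : Set Y) (f : Y → ℂ), IsOpen[T.top] U → T.IsRegular U f →
    S.IsRegular (φ ⁻¹' U) (f ∘ φ)

/-- Isomorphism: a bijection which is a morphism in both directions. -/
def IsIsomorphic {X Y : Type} (S : SpaceWithFunctions X) (T : SpaceWithFunctions Y) : Prop :=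
  ∃ e : X ≃ Y, S.IsMorphism T e ∧ T.IsMorphism S e.symm

/-- The structure induced along `i : Z → X`: the initial topology, and the functions that are
locally restrictions of regular functions on open subsets of `X`. For the inclusion of a locally
closed subset of a variety this is the usual (reduced) subvariety structure. -/
def induced {X Z : Type} (S : SpaceWithFunctions X) (i : Z → X) : SpaceWithFunctions Z where
  top := S.top.induced i
  IsRegular U f := ∀ z ∈ U, ∃ (W : Set X) (F : X → ℂ), IsOpen[S.top] W ∧ i z ∈ W ∧
    S.IsRegular W F ∧ ∀ w ∈ U, i w ∈ W → f w = F (i w)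
  congr := by
    intro U f g _ hfg h z hz
    obtain ⟨W, F, hW, hzW, hF, hE⟩ := h z hz
    exact ⟨W, F, hW, hzW, hF, fun w hw hwW => (hfg hw).symm.trans (hE w hw hwW)⟩
  mono := by
    intro U V f _ _ hVU h z hz
    obtain ⟨W, F, hW, hzW, hF, hE⟩ := h z (hVU hz)
    exact ⟨W, F, hW, hzW, hF, fun w hw => hE w (hVU hw)⟩
  glue := by
    intro U f _ h z hz
    obtain ⟨V, hV, hzV, hVU, hf⟩ := h z hz
    obtain ⟨W, F, hW, hzW, hF, hE⟩ := hf z hzV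
    obtain ⟨V', hV', rfl⟩ := (@isOpen_induced_iff _ _ S.top _ i).1 hV
    let _ := S.top
    refine ⟨W ∩ V', F, hW.inter hV', ⟨hzW, hzV⟩,
      S.mono hW (hW.inter hV') Set.inter_subset_left hF, ?_⟩
    exact fun w _ hwW => hE w hwW.2 hwW.1
  const := by
    intro U c _ z _
    exact ⟨Set.univ, fun _ => c, @isOpen_univ _ S.top, trivial,
      S.const c (@isOpen_univ _ S.top), fun _ _ _ => rfl⟩
  add := by
    intro U f g _ hf hg z hz
    obtain ⟨W, F, hW, hzW, hF, hE⟩ := hf z hz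
    obtain ⟨W', F', hW', hzW', hF', hE'⟩ := hg z hz
    let _ := S.top
    have ho := hW.inter hW'
    refine ⟨W ∩ W', fun x => F x + F' x, ho, ⟨hzW, hzW'⟩,
      S.add ho (S.mono hW ho Set.inter_subset_left hF)
        (S.mono hW' ho Set.inter_subset_right hF'), fun w hw hwW => ?_⟩
    simp only [hE w hw hwW.1, hE' w hw hwW.2]
  mul := by
    intro U f g _ hf hg z hz
    obtain ⟨W, F, hW, hzW, hF, hE⟩ := hf z hz
    obtain ⟨W', F', hW', hzW', hF', hE'⟩ := hg z hz
    let _ := S.top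
    have ho := hW.inter hW'
    refine ⟨W ∩ W', fun x => F x * F' x, ho, ⟨hzW, hzW'⟩,
      S.mul ho (S.mono hW ho Set.inter_subset_left hF)
        (S.mono hW' ho Set.inter_subset_right hF'), fun w hw hwW => ?_⟩
    simp only [hE w hw hwW.1, hE' w hw hwW.2]

/-- The quotient structure along `p : X → Y`: `U ⊆ Y` is open iff `p ⁻¹' U` is, and `f` is regular
on `U` iff `f ∘ p` is regular on `p ⁻¹' U`. -/
def quotient {X Y : Type} (S : SpaceWithFunctions X) (p : X → Y) : SpaceWithFunctions Y where
  top := S.top.coinduced p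
  IsRegular U f := S.IsRegular (p ⁻¹' U) (f ∘ p)
  congr := fun hU hfg h => S.congr hU (fun _ hx => hfg hx) h
  mono := fun hU hW hWU h => S.mono hU hW (Set.preimage_mono hWU) h
  glue := by
    intro U f hU h
    refine S.glue hU fun x hx => ?_
    obtain ⟨W, hW, hxW, hWU, hf⟩ := h (p x) hx
    exact ⟨p ⁻¹' W, hW, hxW, Set.preimage_mono hWU, hf⟩
  const := fun c hU => S.const c hU
  add := fun hU hf hg => S.add hU hf hg
  mul := fun hU hf hg => S.mul hU hf hg

end SpaceWithFunctions

/-- The Zariski topology on `ℂ^σ`: the closed sets are the common zero sets of polynomials. -/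
def zariskiTopology (σ : Type) : TopologicalSpace (σ → ℂ) :=
  TopologicalSpace.ofClosed
    {Z | ∃ P : Set (MvPolynomial σ ℂ), Z = {x | ∀ p ∈ P, MvPolynomial.eval x p = 0}}
    ⟨{1}, by ext x; simp⟩
    (by
      intro A hA
      refine ⟨{p | ∃ Z ∈ A, ∀ x ∈ Z, MvPolynomial.eval x p = 0}, ?_⟩
      ext x
      constructor
      · rintro hx p ⟨Z, hZ, hp⟩
        exact hp x (hx Z hZ)
      · intro hx Z hZ
        obtain ⟨P, rfl⟩ := hA hZ
        exact fun p hp => hx p ⟨_, hZ, fun y hy => hy p hp⟩)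
    (by
      rintro _ ⟨P, rfl⟩ _ ⟨Q, rfl⟩
      refine ⟨{r | ∃ p ∈ P, ∃ q ∈ Q, r = p * q}, ?_⟩
      ext x
      constructor
      · rintro (hx | hx) _ ⟨p, hp, q, hq, rfl⟩
        · simp [hx p hp]
        · simp [hx q hq]
      · intro hx
        by_contra hcon
        simp only [Set.mem_union, Set.mem_ofPred_eq, not_or, not_forall] at hcon
        obtain ⟨⟨p, hp, hp0⟩, q, hq, hq0⟩ := hcon
        have h := hx _ ⟨p, hp, q, hq, rfl⟩
        rw [map_mul] at h
        exact (mul_ne_zero hp0 hq0) h)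

/-- The affine space `ℂ^σ` as a variety: the Zariski topology, and the functions which are locally
quotients of polynomials. -/
def affineSpace (σ : Type) : SpaceWithFunctions (σ → ℂ) where
  top := zariskiTopology σ
  IsRegular U f := ∀ x ∈ U, ∃ W : Set (σ → ℂ), IsOpen[zariskiTopology σ] W ∧ x ∈ W ∧
    ∃ P Q : MvPolynomial σ ℂ, ∀ y ∈ U ∩ W,
      MvPolynomial.eval y Q ≠ 0 ∧ f y = MvPolynomial.eval y P / MvPolynomial.eval y Q
  congr := by
    intro U f g _ hfg h x hx
    obtain ⟨W, hW, hxW, P, Q, hE⟩ := h x hx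
    exact ⟨W, hW, hxW, P, Q, fun y hy => ⟨(hE y hy).1, (hfg hy.1).symm.trans (hE y hy).2⟩⟩
  mono := by
    intro U V f _ _ hVU h x hx
    obtain ⟨W, hW, hxW, P, Q, hE⟩ := h x (hVU hx)
    exact ⟨W, hW, hxW, P, Q, fun y hy => hE y ⟨hVU hy.1, hy.2⟩⟩
  glue := by
    intro U f _ h x hx
    obtain ⟨V, hV, hxV, hVU, hf⟩ := h x hx
    obtain ⟨W, hW, hxW, P, Q, hE⟩ := hf x hxV
    let _ := zariskiTopology σ
    exact ⟨V ∩ W, hV.inter hW, ⟨hxV, hxW⟩, P, Q, fun y hy => hE y hy.2⟩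
  const := by
    intro U c _ x _
    exact ⟨Set.univ, @isOpen_univ _ (zariskiTopology σ), trivial, MvPolynomial.C c, 1,
      fun y _ => by simp⟩
  add := by
    intro U f g _ hf hg x hx
    obtain ⟨W, hW, hxW, P, Q, hE⟩ := hf x hx
    obtain ⟨W', hW', hxW', P', Q', hE'⟩ := hg x hx
    let _ := zariskiTopology σ
    refine ⟨W ∩ W', hW.inter hW', ⟨hxW, hxW'⟩, P * Q' + Q * P', Q * Q', fun y hy => ?_⟩
    obtain ⟨h1, h2⟩ := hE y ⟨hy.1, hy.2.1⟩
    obtain ⟨h3, h4⟩ := hE' y ⟨hy.1, hy.2.2⟩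
    refine ⟨by simpa using ⟨h1, h3⟩, ?_⟩
    simp only [h2, h4, map_add, map_mul]
    rw [div_add_div _ _ h1 h3]
  mul := by
    intro U f g _ hf hg x hx
    obtain ⟨W, hW, hxW, P, Q, hE⟩ := hf x hx
    obtain ⟨W', hW', hxW', P', Q', hE'⟩ := hg x hx
    let _ := zariskiTopology σ
    refine ⟨W ∩ W', hW.inter hW', ⟨hxW, hxW'⟩, P * P', Q * Q', fun y hy => ?_⟩
    obtain ⟨h1, h2⟩ := hE y ⟨hy.1, hy.2.1⟩
    obtain ⟨h3, h4⟩ := hE' y ⟨hy.1, hy.2.2⟩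
    refine ⟨by simpa using ⟨h1, h3⟩, ?_⟩
    simp only [h2, h4, map_mul]
    rw [div_mul_div_comm]

/-- `cells` is an affine paving of the space with functions `S`, the cell with index `i` being of
dimension `dim i`: the cells are locally closed, they partition the space, in a suitable order all
initial unions are closed, and the `i`-th cell is isomorphic to the affine space `ℂ^(dim i)`. -/
structure IsAffinePaving {X ι : Type} [Fintype ι] (S : SpaceWithFunctions X) (cells : ι → Set X)
    (dim : ι → ℕ) : Prop where
  isLocallyClosed : ∀ i, @IsLocallyClosed X S.top (cells i)
  disjoint : Pairwise fun i j => Disjoint (cells i) (cells j)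
  cover : ⋃ i, cells i = Set.univ
  filtration : ∃ e : Fin (Fintype.card ι) ≃ ι, ∀ k, IsClosed[S.top] (⋃ j ≤ k, cells (e j))
  isAffine : ∀ i,
    (S.induced (Subtype.val : cells i → X)).IsIsomorphic (affineSpace (Fin (dim i)))

/-- Complete flags `ℂ^n = V_0 ⊇ V_1 ⊇ ⋯ ⊇ V_{n-1}` with `dim V_i = n - i` (indices from `0`). -/
@[ext]
structure CompleteFlag (n : ℕ) where
  sub : Fin n → Submodule ℂ (Fin n → ℂ)
  antitone_sub : Antitone sub
  finrank_sub : ∀ i, Module.finrank ℂ (sub i) = n - (i : ℕ)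

/-- The flag of an invertible matrix `g`: `V_i` is spanned by the columns `i, …, n - 1` of `g`. -/
def flagOfMatrix (n : ℕ) (g : GL (Fin n) ℂ) : CompleteFlag n where
  sub i := Submodule.span ℂ ((g : Matrix (Fin n) (Fin n) ℂ).col '' Set.Ici i)
  antitone_sub := fun _ _ hij => Submodule.span_mono (Set.image_mono (Set.Ici_subset_Ici.2 hij))
  finrank_sub := by
    intro i
    have h : LinearIndependent ℂ (g : Matrix (Fin n) (Fin n) ℂ).col :=
      Matrix.linearIndependent_cols_of_isUnit g.isUnit
    have h' := h.comp (Subtype.val : Set.Ici i → Fin n) Subtype.val_injective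
    have h2 := finrank_span_eq_card h'
    rw [Set.range_comp, Subtype.range_coe] at h2
    rw [h2, ← Set.toFinset_card, Set.toFinset_Ici, Fin.card_Ici]

/-- The variety `GL_n(ℂ)`, as an open subset of the affine space of matrices. -/
def generalLinearVariety (n : ℕ) : SpaceWithFunctions (GL (Fin n) ℂ) :=
  (affineSpace (Fin n × Fin n)).induced fun g p => (g : Matrix (Fin n) (Fin n) ℂ) p.1 p.2

/-- The flag variety `Fl(ℂ^n) = GL_n(ℂ) / B`. -/
def flagVariety (n : ℕ) : SpaceWithFunctions (CompleteFlag n) :=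
  (generalLinearVariety n).quotient (flagOfMatrix n)

/-- The shift operator: `e_i ↦ e_{i+m}` if `i + m` is still an index, and `e_i ↦ 0` otherwise. -/
noncomputable def shiftOperator (n m : ℕ) : (Fin n → ℂ) →ₗ[ℂ] (Fin n → ℂ) :=
  (Pi.basisFun ℂ (Fin n)).constr ℂ fun i =>
    if h : (i : ℕ) + m < n then Pi.single ⟨(i : ℕ) + m, h⟩ 1 else 0

/-- The Springer fiber: the flags with `T V_i ⊆ V_i` for all `i`. -/
def springerFiber {n : ℕ} (T : (Fin n → ℂ) →ₗ[ℂ] (Fin n → ℂ)) : Set (CompleteFlag n) :=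
  {F | ∀ i, (F.sub i).map T ≤ F.sub i}

/-- The Springer fiber as a subvariety of the flag variety. -/
def springerVariety {n : ℕ} (T : (Fin n → ℂ) →ₗ[ℂ] (Fin n → ℂ)) :
    SpaceWithFunctions (springerFiber T) :=
  (flagVariety n).induced Subtype.val

/-- The Schubert cell of `w`: the flags with `V_i` spanned by `v^{w(i)}, …, v^{w(n-1)}` for some
vectors of the form `v^a = e_a + ∑_{b > a} c_{a,b} e_b`. -/
def schubertCell {n : ℕ} (w : Equiv.Perm (Fin n)) : Set (CompleteFlag n) :=
  {F | ∃ c : Fin n → Fin n → ℂ, ∀ i, F.sub i = Submodule.span ℂ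
    ((fun j : Fin n => (Pi.single (w j) 1 : Fin n → ℂ) +
      ∑ b ∈ Finset.Ioi (w j), c (w j) b • (Pi.single b 1 : Fin n → ℂ)) '' Set.Ici i)}

/-- The intersection of the Schubert cell of `w` with the Springer fiber of `T`. -/
def springerCell {n : ℕ} (T : (Fin n → ℂ) →ₗ[ℂ] (Fin n → ℂ)) (w : Equiv.Perm (Fin n)) :
    Set (springerFiber T) :=
  {F | (F : CompleteFlag n) ∈ schubertCell w}

/-- Finite `m`-stable permutations: `w(x + m) > w(x)` whenever `x` and `x + m` are indices. -/
def IsStable {n : ℕ} (m : ℕ) (w : Equiv.Perm (Fin n)) : Prop :=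
  ∀ x y : Fin n, (y : ℕ) = (x : ℕ) + m → w x < w y

/-- Finite `m`-restricted permutations: those with `m`-stable inverse. -/
def IsRestricted {n : ℕ} (m : ℕ) (w : Equiv.Perm (Fin n)) : Prop :=
  IsStable m w⁻¹

/-- The number of inversions `(i, j)` of `w` (so `i < j` and `w(i) > w(j)`) of height `j - i`
less than `m`. -/
def inversionsBelow {n : ℕ} (m : ℕ) (w : Equiv.Perm (Fin n)) : ℕ :=
  (Finset.univ.filter fun p : Fin n × Fin n =>
    p.1 < p.2 ∧ w p.2 < w p.1 ∧ (p.2 : ℕ) - (p.1 : ℕ) < m).card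

noncomputable instance fintypeRestricted (n m : ℕ) :
    Fintype {w : Equiv.Perm (Fin n) // IsRestricted m w} :=
  Fintype.ofFinite _

/-! Write `N` for the shift operator. Every flag has a unique permutation `w` and a unique adapted
basis `u` in reduced echelon form: `u j` starts with a 1 at its pivot `w j` and vanishes at `w k`
for `k > j`. If the flag is `N`-stable and `w j + m` is an index, then `N (u j)` starts there, so
this position is the pivot of a later vector. Hence only restricted `w` occur
(`isRestricted_of_mem`).

For restricted `w` one solves for `u j` by descending `j`. Stability says that `N (u j)` lies in the
span of the later vectors, and a vector of that span is determined by its entries at their pivots.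
So the entry of `u j` at `b` is forced when `b + m` is an index with `w⁻¹ (b + m) ≤ j`. Every other
entry is either prescribed by the reduced echelon form or free (`IsFreePair`). Restrictedness makes
forced and prescribed entries compatible, so the free entries are coordinates on the cell
(`exists_parametrization`, `eq_of_free_coordinates`). They depend regularly on the flag by Cramer's
rule (`isRegular_chartBasis`), and `card_isFreePair` counts them.

For the filtration, each cell lies in an open chart, and any other cell meeting that chart has
smaller `cellHeight` (`cellHeight_lt`). Listing the cells by decreasing height makes the complement
of each initial union a union of charts. -/

namespace SpaceWithFunctions

/-! ### Morphisms of spaces with functions. -/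

variable {X Y Z : Type}

/-- The algebra of regular functions on an open set. -/
def regularFunctions (S : SpaceWithFunctions X) (U : Set X) (hU : IsOpen[S.top] U) :
    Subalgebra ℂ (X → ℂ) where
  carrier := {f | S.IsRegular U f}
  mul_mem' hf hg := S.mul hU hf hg
  add_mem' hf hg := S.add hU hf hg
  algebraMap_mem' c := S.const c hU

/-- The algebra of functions that are regular on the whole space. -/
abbrev globalFunctions (S : SpaceWithFunctions X) : Subalgebra ℂ (X → ℂ) :=
  S.regularFunctions Set.univ (@isOpen_univ _ S.top)

/-- The nonvanishing locus of a regular function is open, and the inverse is regular there. -/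
def HasInverses (S : SpaceWithFunctions X) : Prop :=
  ∀ (U : Set X) (f : X → ℂ), IsOpen[S.top] U → S.IsRegular U f →
    IsOpen[S.top] {x | x ∈ U ∧ f x ≠ 0} ∧ S.IsRegular {x | x ∈ U ∧ f x ≠ 0} fun x => (f x)⁻¹

theorem IsMorphism.comp {S : SpaceWithFunctions X} {T : SpaceWithFunctions Y}
    {R : SpaceWithFunctions Z} {φ : X → Y} {ψ : Y → Z} (hψ : T.IsMorphism R ψ)
    (hφ : S.IsMorphism T φ) : S.IsMorphism R (ψ ∘ φ) :=
  ⟨fun U hU => hφ.1 _ (hψ.1 U hU), fun U f hU hf => hφ.2 _ _ (hψ.1 U hU) (hψ.2 U f hU hf)⟩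

theorem isMorphism_induced (S : SpaceWithFunctions X) (i : Z → X) :
    (S.induced i).IsMorphism S i := by
  refine ⟨fun U hU => ⟨U, hU, rfl⟩, fun U f hU hf z hz => ⟨U, f, hU, hz, hf, fun _ _ _ => rfl⟩⟩

theorem isMorphism_quotient (S : SpaceWithFunctions X) (p : X → Y) :
    S.IsMorphism (S.quotient p) p :=
  ⟨fun _ hU => hU, fun _ _ _ hf => hf⟩

/-- Universal property of the induced structure: regularity is local on the source, and locally the
function extends to `X`. -/
theorem IsMorphism.codRestrict {S : SpaceWithFunctions X} {T : SpaceWithFunctions Y} {i : Z → X}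
    {φ : Y → Z} (h : T.IsMorphism S (i ∘ φ)) : T.IsMorphism (S.induced i) φ := by
  have hcont : ∀ U, IsOpen[(S.induced i).top] U → IsOpen[T.top] (φ ⁻¹' U) := by
    rintro _ ⟨V, hV, rfl⟩
    exact h.1 V hV
  refine ⟨hcont, fun U f hU hf => T.glue (hcont U hU) fun y hy => ?_⟩
  obtain ⟨W, F, hW, hyW, hF, hE⟩ := hf (φ y) hy
  let _ := T.top
  have ho : IsOpen (φ ⁻¹' U ∩ (i ∘ φ) ⁻¹' W) := IsOpen.inter (hcont U hU) (h.1 W hW)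
  refine ⟨_, ho, ⟨hy, hyW⟩, Set.inter_subset_left, ?_⟩
  refine T.congr ho (fun z hz => (hE (φ z) hz.1 hz.2).symm) ?_
  exact T.mono (h.1 W hW) ho Set.inter_subset_right (h.2 W F hW hF)

theorem isClosed_zariskiTopology_iff {σ : Type} {Z : Set (σ → ℂ)} :
    IsClosed[zariskiTopology σ] Z ↔
      ∃ P : Set (MvPolynomial σ ℂ), Z = {x | ∀ p ∈ P, MvPolynomial.eval x p = 0} := by
  rw [← @isOpen_compl_iff _ _ (zariskiTopology σ)]
  change Zᶜᶜ ∈ _ ↔ _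
  rw [compl_compl]
  rfl

/-- Invertibility is not an axiom of `SpaceWithFunctions`. It is needed to pull back quotients `P /
Q`, and it passes from affine space to the other spaces through `induced` and `quotient`. -/
theorem hasInverses_affineSpace (σ : Type) : (affineSpace σ).HasInverses := by
  intro U f hU hf
  let _ := zariskiTopology σ
  have hD : ∀ P : MvPolynomial σ ℂ, IsOpen {x : σ → ℂ | MvPolynomial.eval x P ≠ 0} := by
    intro P
    rw [← isClosed_compl_iff]
    have : IsClosed {x : σ → ℂ | ∀ p ∈ ({P} : Set (MvPolynomial σ ℂ)),
        MvPolynomial.eval x p = 0} :=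
      isClosed_zariskiTopology_iff.2 ⟨{P}, rfl⟩
    convert this using 1
    ext x
    simp
  have hopen : IsOpen {x | x ∈ U ∧ f x ≠ 0} := by
    rw [isOpen_iff_forall_mem_open]
    rintro x ⟨hx, hfx⟩
    obtain ⟨W, hW, hxW, P, Q, hE⟩ := hf x hx
    refine ⟨U ∩ W ∩ {x | MvPolynomial.eval x P ≠ 0}, ?_, ?_, ⟨⟨hx, hxW⟩, ?_⟩⟩
    · rintro y ⟨hy, hyP⟩
      refine ⟨hy.1, ?_⟩
      rw [(hE y hy).2]
      exact div_ne_zero hyP (hE y hy).1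
    · exact (IsOpen.inter hU hW).inter (hD P)
    · intro h0
      apply hfx
      rw [(hE x ⟨hx, hxW⟩).2, h0, zero_div]
  refine ⟨hopen, ?_⟩
  rintro x ⟨hx, hfx⟩
  obtain ⟨W, hW, hxW, P, Q, hE⟩ := hf x hx
  refine ⟨W, hW, hxW, Q, P, ?_⟩
  rintro y ⟨⟨hy, hfy⟩, hyW⟩
  obtain ⟨h1, h2⟩ := hE y ⟨hy, hyW⟩
  refine ⟨fun h0 => hfy (by rw [h2, h0, zero_div]), ?_⟩
  simp only [h2, inv_div]

theorem HasInverses.quotient {S : SpaceWithFunctions X} (h : S.HasInverses) (p : X → Y) :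
    (S.quotient p).HasInverses :=
  fun U f hU hf => h (p ⁻¹' U) (f ∘ p) hU hf

theorem HasInverses.induced {S : SpaceWithFunctions X} (h : S.HasInverses) (i : Z → X) :
    (S.induced i).HasInverses := by
  intro U f hU hf
  let _ := (S.induced i).top
  constructor
  · rw [isOpen_iff_forall_mem_open]
    rintro z ⟨hz, hfz⟩
    obtain ⟨W, F, hW, hzW, hF, hE⟩ := hf z hz
    refine ⟨U ∩ i ⁻¹' {x | x ∈ W ∧ F x ≠ 0}, ?_, ?_, hz, hzW, ?_⟩
    · rintro y ⟨hy, hyW, hFy⟩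
      exact ⟨hy, by rwa [hE y hy hyW]⟩
    · exact IsOpen.inter hU ⟨_, (h W F hW hF).1, rfl⟩
    · rwa [← hE z hz hzW]
  · rintro z ⟨hz, hfz⟩
    obtain ⟨W, F, hW, hzW, hF, hE⟩ := hf z hz
    refine ⟨{x | x ∈ W ∧ F x ≠ 0}, fun x => (F x)⁻¹, (h W F hW hF).1, ⟨hzW, ?_⟩,
      (h W F hW hF).2, ?_⟩
    · rwa [← hE z hz hzW]
    · rintro y ⟨hy, -⟩ ⟨hyW, -⟩
      simp only [hE y hy hyW]

theorem HasInverses.isOpen_ne_zero {S : SpaceWithFunctions X} (h : S.HasInverses) {f : X → ℂ}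
    (hf : f ∈ S.globalFunctions) : IsOpen[S.top] {x | f x ≠ 0} := by
  simpa using (h _ f (@isOpen_univ _ S.top) hf).1

theorem HasInverses.isClosed_eq_zero {S : SpaceWithFunctions X} (h : S.HasInverses) {f : X → ℂ}
    (hf : f ∈ S.globalFunctions) : IsClosed[S.top] {x | f x = 0} := by
  let _ := S.top
  rw [← isOpen_compl_iff]
  exact h.isOpen_ne_zero hf

/-- A quotient of global functions is regular where the denominator does not vanish. -/
theorem HasInverses.isRegular_div {S : SpaceWithFunctions X} (h : S.HasInverses) {f g : X → ℂ}
    (hf : f ∈ S.globalFunctions) (hg : g ∈ S.globalFunctions) :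
    S.IsRegular {x | g x ≠ 0} fun x => f x / g x := by
  have ho := h.isOpen_ne_zero hg
  have hi : S.IsRegular {x | g x ≠ 0} fun x => (g x)⁻¹ := by
    simpa using (h _ g (@isOpen_univ _ S.top) hg).2
  simp only [div_eq_mul_inv]
  exact S.mul ho (S.mono (@isOpen_univ _ S.top) ho (Set.subset_univ _) hf) hi

theorem eval_comp_mem_globalFunctions {S : SpaceWithFunctions X} {σ : Type} {ψ : X → σ → ℂ}
    (hψ : ∀ s, (fun x => ψ x s) ∈ S.globalFunctions) (P : MvPolynomial σ ℂ) :
    (fun x => MvPolynomial.eval (ψ x) P) ∈ S.globalFunctions := by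
  induction P using MvPolynomial.induction_on with
  | C a => simp only [MvPolynomial.eval_C]; exact S.const a (@isOpen_univ _ S.top)
  | add p q hp hq => simp only [map_add]; exact add_mem hp hq
  | mul_X p s hp => simp only [map_mul, MvPolynomial.eval_X]; exact mul_mem hp (hψ s)

/-- A map to affine space whose coordinates are regular functions is a morphism. -/
theorem HasInverses.isMorphism_affineSpace {S : SpaceWithFunctions X} (h : S.HasInverses)
    {σ : Type} {ψ : X → σ → ℂ} (hψ : ∀ s, (fun x => ψ x s) ∈ S.globalFunctions) :
    S.IsMorphism (affineSpace σ) ψ := by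
  let _ := S.top
  have hcont : ∀ U, IsOpen[zariskiTopology σ] U → IsOpen (ψ ⁻¹' U) := by
    intro U hU
    have hU' : IsClosed[zariskiTopology σ] Uᶜ := (@isClosed_compl_iff _ (zariskiTopology σ) _).2 hU
    obtain ⟨P, hP⟩ := isClosed_zariskiTopology_iff.1 hU'
    rw [← isClosed_compl_iff, ← Set.preimage_compl, hP]
    have : ψ ⁻¹' {x | ∀ p ∈ P, MvPolynomial.eval x p = 0} =
        ⋂ p ∈ P, {x | MvPolynomial.eval (ψ x) p = 0} := by
      ext x; simp
    rw [this]
    exact isClosed_biInter fun p _ => h.isClosed_eq_zero (eval_comp_mem_globalFunctions hψ p)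
  refine ⟨hcont, fun U f hU hf => S.glue (hcont U hU) fun x hx => ?_⟩
  obtain ⟨W, hW, hxW, P, Q, hE⟩ := hf (ψ x) hx
  have ho : IsOpen (ψ ⁻¹' U ∩ ψ ⁻¹' W) := (hcont U hU).inter (hcont W hW)
  refine ⟨_, ho, ⟨hx, hxW⟩, Set.inter_subset_left, ?_⟩
  have hP := eval_comp_mem_globalFunctions hψ P
  have hQ := eval_comp_mem_globalFunctions hψ Q
  refine S.congr ho (f := fun x => MvPolynomial.eval (ψ x) P / MvPolynomial.eval (ψ x) Q)
    (fun y hy => (hE (ψ y) hy).2.symm) ?_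
  exact S.mono (h.isOpen_ne_zero hQ) ho (fun y hy => (hE (ψ y) hy).1) (h.isRegular_div hP hQ)

theorem coordinate_mem_globalFunctions {σ : Type} (s : σ) :
    (fun x : σ → ℂ => x s) ∈ (affineSpace σ).globalFunctions := fun _ _ =>
  ⟨Set.univ, @isOpen_univ _ (zariskiTopology σ), trivial, MvPolynomial.X s, 1, fun y _ => by simp⟩

theorem IsMorphism.comp_mem_globalFunctions {S : SpaceWithFunctions X} {T : SpaceWithFunctions Y}
    {φ : X → Y} (h : S.IsMorphism T φ) {f : Y → ℂ} (hf : f ∈ T.globalFunctions) :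
    (fun x => f (φ x)) ∈ S.globalFunctions :=
  h.2 Set.univ f (@isOpen_univ _ T.top) hf

end SpaceWithFunctions

/-! ### Determinants and adjugates with entries in an algebra of functions. -/

theorem Subalgebra.sum_fun_mem {X ι : Type} (A : Subalgebra ℂ (X → ℂ)) (s : Finset ι)
    {f : ι → X → ℂ} (hf : ∀ i ∈ s, f i ∈ A) : (fun x => ∑ i ∈ s, f i x) ∈ A := by
  convert sum_mem hf using 1
  ext x
  simp

theorem Subalgebra.det_mem {X : Type} (A : Subalgebra ℂ (X → ℂ)) {n : ℕ}
    {M : X → Matrix (Fin n) (Fin n) ℂ} (hM : ∀ i j, (fun x => M x i j) ∈ A) :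
    (fun x => (M x).det) ∈ A := by
  simp only [Matrix.det_apply']
  refine A.sum_fun_mem _ fun σ _ => ?_
  refine A.mul_mem (x := fun _ => _) (A.algebraMap_mem _) ?_
  convert A.prod_mem (t := Finset.univ) (f := fun i x => M x (σ i) i)
    (fun i _ => hM (σ i) i) using 1
  ext x
  simp

theorem Subalgebra.adjugate_mem {X : Type} (A : Subalgebra ℂ (X → ℂ)) {n : ℕ}
    {M : X → Matrix (Fin n) (Fin n) ℂ} (hM : ∀ i j, (fun x => M x i j) ∈ A) (i j : Fin n) :
    (fun x => (M x).adjugate i j) ∈ A := by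
  simp only [Matrix.adjugate_apply]
  refine A.det_mem fun k l => ?_
  by_cases h : k = j
  · simp only [Matrix.updateRow_apply, h, if_true]
    exact A.algebraMap_mem ((Pi.single i 1 : Fin n → ℂ) l)
  · simpa [Matrix.updateRow_apply, h] using hM k l

/-! ### Triangular systems of vectors and their pivots. -/

section Triangular

variable {n : ℕ} {w : Equiv.Perm (Fin n)} {u : Fin n → Fin n → ℂ}

theorem mem_span_image_Ici_iff {u : Fin n → Fin n → ℂ} {i : Fin n} {x : Fin n → ℂ} :
    x ∈ Submodule.span ℂ (u '' Set.Ici i) ↔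
      ∃ c : Fin n → ℂ, (∀ k < i, c k = 0) ∧ ∑ k, c k • u k = x := by
  constructor
  · intro hx
    induction hx using Submodule.span_induction with
    | mem x hx =>
      obtain ⟨k, hk, rfl⟩ := hx
      refine ⟨Pi.single k 1, fun l hl => Pi.single_eq_of_ne (hl.trans_le hk).ne _, ?_⟩
      simp [Pi.single_apply]
    | zero => exact ⟨0, by simp, by simp⟩
    | add x y _ _ hx hy =>
      obtain ⟨c, hc, rfl⟩ := hx
      obtain ⟨d, hd, rfl⟩ := hy
      exact ⟨c + d, fun k hk => by simp [hc k hk, hd k hk],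
        by simp [add_smul, Finset.sum_add_distrib]⟩
    | smul a x _ hx =>
      obtain ⟨c, hc, rfl⟩ := hx
      exact ⟨a • c, fun k hk => by simp [hc k hk], by simp [Finset.smul_sum, mul_smul]⟩
  · rintro ⟨c, hc, rfl⟩
    refine Submodule.sum_mem _ fun k _ => ?_
    by_cases hk : k < i
    · simp [hc k hk]
    · exact Submodule.smul_mem _ _ (Submodule.subset_span ⟨k, not_lt.1 hk, rfl⟩)

/-- A triangular system of vectors: a linear combination whose coefficients or whose values at
the pivots vanish is trivial. -/
theorem eq_zero_of_triangular (r : Fin n → ℕ) (h1 : ∀ k, u k (w k) = 1)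
    (h0 : ∀ l k, l ≠ k → r k ≤ r l → u l (w k) = 0) {c : Fin n → ℂ}
    (hc : ∀ k, c k = 0 ∨ (∑ l, c l • u l) (w k) = 0) (k : Fin n) : c k = 0 := by
  -- At the pivot `w k`, terms of smaller rank have zero coefficient by induction, and the other
  -- terms `l ≠ k` vanish by `h0`.
  induction hr : r k using Nat.strong_induction_on generalizing k with
  | _ N ih =>
    subst hr
    rcases hc k with h | h
    · exact h
    rw [Finset.sum_apply, Finset.sum_eq_single k] at h
    · simpa [h1] using h
    · intro l _ hl
      rcases lt_or_ge (r l) (r k) with hlt | hge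
      · simp [ih _ hlt l rfl]
      · simp [h0 l k hl hge]
    · simp

/-- The vector `u j` has value `1` at its pivot `w j` and vanishes before it. -/
structure IsEchelon (w : Equiv.Perm (Fin n)) (u : Fin n → Fin n → ℂ) : Prop where
  pivot : ∀ j, u j (w j) = 1
  eq_zero : ∀ j b, b < w j → u j b = 0

/-- The vector `u j` has value `1` at its pivot `w j` and vanishes at the pivots of later
vectors. -/
structure PivotReduced (w : Equiv.Perm (Fin n)) (u : Fin n → Fin n → ℂ) : Prop where
  pivot : ∀ j, u j (w j) = 1
  eq_zero : ∀ j k, j < k → u j (w k) = 0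

theorem IsEchelon.coeff_eq_zero (h : IsEchelon w u) {c : Fin n → ℂ}
    (hc : ∀ k, c k = 0 ∨ (∑ l, c l • u l) (w k) = 0) (k : Fin n) : c k = 0 :=
  eq_zero_of_triangular (fun i => (w i : ℕ)) h.pivot
    (fun l _ hlk hr => h.eq_zero l _ (lt_of_le_of_ne hr fun he => hlk (w.injective he.symm))) hc k

theorem PivotReduced.coeff_eq_zero (h : PivotReduced w u) {c : Fin n → ℂ}
    (hc : ∀ k, c k = 0 ∨ (∑ l, c l • u l) (w k) = 0) (k : Fin n) : c k = 0 :=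
  -- The rank `n - i` reverses the order of the indices, because reducedness controls the pivots of
  -- later vectors.
  eq_zero_of_triangular (fun i => n - (i : ℕ)) h.pivot
    (fun l k hlk (hr : n - (k : ℕ) ≤ n - (l : ℕ)) => h.eq_zero l k
      (lt_of_le_of_ne (Fin.le_def.2 (by omega)) hlk)) hc k

theorem IsEchelon.linearIndependent (h : IsEchelon w u) : LinearIndependent ℂ u :=
  Fintype.linearIndependent_iff.2 fun c hc => h.coeff_eq_zero fun _ =>
    Or.inr (by rw [hc, Pi.zero_apply])

theorem PivotReduced.linearIndependent (h : PivotReduced w u) : LinearIndependent ℂ u :=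
  Fintype.linearIndependent_iff.2 fun c hc => h.coeff_eq_zero fun _ =>
    Or.inr (by rw [hc, Pi.zero_apply])

/-- Injectivity of `V_i` into its pivot coordinates; the uniqueness arguments below rest on it. -/
theorem PivotReduced.eq_zero_of_mem_span (h : PivotReduced w u) {i : Fin n} {x : Fin n → ℂ}
    (hx : x ∈ Submodule.span ℂ (u '' Set.Ici i)) (h0 : ∀ k, i ≤ k → x (w k) = 0) : x = 0 := by
  obtain ⟨c, hc, rfl⟩ := mem_span_image_Ici_iff.1 hx
  have := h.coeff_eq_zero (c := c) fun k => (lt_or_ge k i).imp (hc k) (h0 k)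
  simp [this]

/-- Among the terms with nonzero coefficient, the one with the smallest pivot starts strictly before
the others, so its leading entry cannot cancel. -/
theorem IsEchelon.exists_leading_coeff (h : IsEchelon w u) {c : Fin n → ℂ} {j : Fin n}
    (hj : c j ≠ 0) : ∃ k, c k ≠ 0 ∧ w k ≤ w j ∧ (∑ l, c l • u l) (w k) = c k ∧
      ∀ b < w k, (∑ l, c l • u l) b = 0 := by
  obtain ⟨k, hk, hmin⟩ := Finset.exists_min_image (Finset.univ.filter fun k => c k ≠ 0)
    (fun k => w k) ⟨j, by simpa using hj⟩
  simp only [Finset.mem_filter, Finset.mem_univ, true_and] at hk hmin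
  refine ⟨k, hk, hmin j hj, ?_, fun b hb => ?_⟩
  · rw [Finset.sum_apply, Finset.sum_eq_single k]
    · simp [h.pivot]
    · intro l _ hl
      by_cases hcl : c l = 0
      · simp [hcl]
      · have := lt_of_le_of_ne (hmin l hcl) fun he => hl (w.injective he.symm)
        simp [h.eq_zero l _ this]
    · simp
  · rw [Finset.sum_apply]
    refine Finset.sum_eq_zero fun l _ => ?_
    by_cases hcl : c l = 0
    · simp [hcl]
    · simp [h.eq_zero l b (hb.trans_le (hmin l hcl))]

/-- The leading index of a nonzero vector of `V_i` is one of the pivots of `V_i`. -/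
theorem IsEchelon.exists_leading (h : IsEchelon w u) {i : Fin n} {x : Fin n → ℂ}
    (hx : x ∈ Submodule.span ℂ (u '' Set.Ici i)) (h0 : x ≠ 0) :
    ∃ k, i ≤ k ∧ x (w k) ≠ 0 ∧ ∀ b < w k, x b = 0 := by
  obtain ⟨c, hc, rfl⟩ := mem_span_image_Ici_iff.1 hx
  obtain ⟨j, hj⟩ : ∃ j, c j ≠ 0 := by
    by_contra! hcon
    exact h0 (by simp [hcon])
  obtain ⟨k, hk, -, hkx, hlt⟩ := h.exists_leading_coeff hj
  exact ⟨k, not_lt.1 fun hki => hk (hc k hki), by rwa [hkx], hlt⟩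

/-- A nonzero coefficient at `u j` would produce a nonzero entry at or before `w j`. -/
theorem IsEchelon.mem_span_Ioi (h : IsEchelon w u) {j : Fin n} {x : Fin n → ℂ}
    (hx : x ∈ Submodule.span ℂ (u '' Set.Ici j)) (h0 : ∀ b ≤ w j, x b = 0) :
    x ∈ Submodule.span ℂ (u '' Set.Ioi j) := by
  obtain ⟨c, hc, rfl⟩ := mem_span_image_Ici_iff.1 hx
  have hcj : c j = 0 := by
    by_contra hcj
    obtain ⟨k, hk, hkj, hkx, -⟩ := h.exists_leading_coeff hcj
    exact hk (hkx.symm.trans (h0 _ hkj))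
  refine Submodule.sum_mem _ fun k _ => ?_
  rcases lt_trichotomy k j with hk | rfl | hk
  · simp [hc k hk]
  · simp [hcj]
  · exact Submodule.smul_mem _ _ (Submodule.subset_span ⟨k, hk, rfl⟩)

end Triangular

/-! ### Adapted bases and Schubert cells. -/

namespace CompleteFlag

variable {n : ℕ}

/-- The vectors `u` are a basis adapted to the flag `F`. -/
def IsAdapted (F : CompleteFlag n) (u : Fin n → Fin n → ℂ) : Prop :=
  ∀ i, F.sub i = Submodule.span ℂ (u '' Set.Ici i)

theorem IsAdapted.mem {F : CompleteFlag n} {u : Fin n → Fin n → ℂ} (h : F.IsAdapted u)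
    {i j : Fin n} (hij : i ≤ j) : u j ∈ F.sub i := by
  rw [h i]
  exact Submodule.subset_span ⟨j, hij, rfl⟩

theorem IsAdapted.eq {F F' : CompleteFlag n} {u : Fin n → Fin n → ℂ} (h : F.IsAdapted u)
    (h' : F'.IsAdapted u) : F = F' :=
  CompleteFlag.ext (funext fun i => (h i).trans (h' i).symm)

theorem isAdapted_of_linearIndependent {F : CompleteFlag n} {u : Fin n → Fin n → ℂ}
    (h : LinearIndependent ℂ u) (hu : ∀ j, u j ∈ F.sub j) : F.IsAdapted u := by
  intro i
  symm
  apply Submodule.eq_of_le_of_finrank_eq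
  · rw [Submodule.span_le]
    rintro _ ⟨j, hj, rfl⟩
    exact F.antitone_sub hj (hu j)
  · have h' := h.comp (Subtype.val : Set.Ici i → Fin n) Subtype.val_injective
    have h2 := finrank_span_eq_card h'
    rw [Set.range_comp, Subtype.range_coe] at h2
    rw [h2, F.finrank_sub, ← Set.toFinset_card, Set.toFinset_Ici, Fin.card_Ici]

theorem isAdapted_flagOfMatrix (g : GL (Fin n) ℂ) :
    (flagOfMatrix n g).IsAdapted (g : Matrix (Fin n) (Fin n) ℂ).col :=
  fun _ => rfl

/-- The invertible matrix with linearly independent columns `u`. -/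
noncomputable def glOfColumns (u : Fin n → Fin n → ℂ) (h : LinearIndependent ℂ u) :
    GL (Fin n) ℂ :=
  (Matrix.linearIndependent_cols_iff_isUnit (A := Matrix.of fun b j => u j b).1 h).unit

theorem isAdapted_glOfColumns {u : Fin n → Fin n → ℂ} (h : LinearIndependent ℂ u) :
    (flagOfMatrix n (glOfColumns u h)).IsAdapted u :=
  fun _ => rfl

/-- The adapted reduced basis for given pivots is unique. -/
theorem IsAdapted.unique {F : CompleteFlag n} {w : Equiv.Perm (Fin n)} {u u' : Fin n → Fin n → ℂ}
    (h : F.IsAdapted u) (hu : PivotReduced w u) (h' : F.IsAdapted u') (hu' : PivotReduced w u') :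
    u = u' := by
  funext j
  rw [← sub_eq_zero]
  refine hu.eq_zero_of_mem_span (i := j) ?_ fun k hk => ?_
  · rw [← h j]
    exact Submodule.sub_mem _ (h.mem le_rfl) (h'.mem le_rfl)
  · rcases hk.eq_or_lt with rfl | hlt
    · simp [hu.pivot, hu'.pivot]
    · simp [hu.eq_zero j k hlt, hu'.eq_zero j k hlt]

/-- The last `i` vectors are built first. The next space has dimension `i + 1`, and vanishing at the
`i` chosen pivots imposes `i` linear conditions, so a nonzero solution exists; its first nonzero
position is the new pivot. -/
theorem exists_partial_echelon (F : CompleteFlag n) (i : ℕ) :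
    ∃ (u : Fin n → Fin n → ℂ) (w : Fin n → Fin n), ∀ j : Fin n, n ≤ i + j →
      u j ∈ F.sub j ∧ u j (w j) = 1 ∧ (∀ b < w j, u j b = 0) ∧ ∀ k, j < k → u j (w k) = 0 := by
  induction i with
  | zero => exact ⟨0, id, fun j hj => absurd j.2 (by omega)⟩
  | succ i ih =>
    obtain ⟨u, w, h⟩ := ih
    by_cases hi : i < n
    swap
    · exact ⟨u, w, fun j _ => h j (by omega)⟩
    set j₀ : Fin n := ⟨n - 1 - i, by omega⟩ with hj₀
    have hval : (j₀ : ℕ) = n - 1 - i := rfl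
    let L : F.sub j₀ →ₗ[ℂ] (Set.Ioi j₀ → ℂ) :=
      LinearMap.pi fun k => (LinearMap.proj (w k)).comp (F.sub j₀).subtype
    have hL : LinearMap.ker L ≠ ⊥ := by
      apply LinearMap.ker_ne_bot_of_finrank_lt
      rw [F.finrank_sub, Module.finrank_fintype_fun_eq_card, ← Set.toFinset_card,
        Set.toFinset_Ioi, Fin.card_Ioi]
      omega
    obtain ⟨x, hx, hx0⟩ := Submodule.exists_mem_ne_zero_of_ne_bot hL
    have hxw : ∀ k, j₀ < k → (x : Fin n → ℂ) (w k) = 0 := fun k hk =>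
      congrFun (LinearMap.mem_ker.1 hx) ⟨k, hk⟩
    have hne : (Finset.univ.filter fun b => (x : Fin n → ℂ) b ≠ 0).Nonempty := by
      by_contra hcon
      apply hx0
      ext b
      have : ∀ b, (x : Fin n → ℂ) b = 0 := by
        simpa [Finset.not_nonempty_iff_eq_empty, Finset.filter_eq_empty_iff] using hcon
      simp [this]
    obtain ⟨b, hb, hmin⟩ := Finset.exists_min_image _ id hne
    simp only [Finset.mem_filter, Finset.mem_univ, true_and, id] at hb hmin
    refine ⟨Function.update u j₀ (((x : Fin n → ℂ) b)⁻¹ • (x : Fin n → ℂ)),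
      Function.update w j₀ b, fun j hj => ?_⟩
    rcases eq_or_ne j j₀ with rfl | hne
    · simp only [Function.update_self]
      refine ⟨Submodule.smul_mem _ _ x.2, by simp [hb], fun a ha => ?_, fun k hk => ?_⟩
      · have : (x : Fin n → ℂ) a = 0 := by
          by_contra hcon
          exact absurd (hmin a hcon) (not_le.2 ha)
        simp [this]
      · rw [Function.update_of_ne hk.ne']
        simp [hxw k hk]
    · have hne' : (j : ℕ) ≠ j₀ := fun he => hne (Fin.ext he)
      obtain ⟨h1, h2, h3, h4⟩ := h j (by omega)
      rw [Function.update_of_ne hne, Function.update_of_ne hne]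
      refine ⟨h1, h2, h3, fun k hk => ?_⟩
      have hk' : (j : ℕ) < k := hk
      have : k ≠ j₀ := fun he => by rw [he] at hk'; omega
      rw [Function.update_of_ne this]
      exact h4 k hk

/-- Every flag has an adapted basis in reduced echelon form. -/
theorem exists_echelon_reduced (F : CompleteFlag n) :
    ∃ (w : Equiv.Perm (Fin n)) (u : Fin n → Fin n → ℂ),
      F.IsAdapted u ∧ IsEchelon w u ∧ PivotReduced w u := by
  obtain ⟨u, w, h⟩ := F.exists_partial_echelon n
  replace h := fun j => h j (by omega)
  have hw : Function.Injective w := by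
    have key : ∀ j k, j < k → w j ≠ w k := fun j k hjk he => by
      have h1 := (h j).2.1
      rw [he, (h j).2.2.2 k hjk] at h1
      exact zero_ne_one h1
    intro j k he
    rcases lt_trichotomy j k with hlt | rfl | hgt
    · exact absurd he (key _ _ hlt)
    · rfl
    · exact absurd he.symm (key _ _ hgt)
  have hr : PivotReduced (Equiv.ofBijective w (Finite.injective_iff_bijective.1 hw)) u :=
    ⟨fun j => (h j).2.1, fun j => (h j).2.2.2⟩
  exact ⟨_, u, isAdapted_of_linearIndependent hr.linearIndependent fun j => (h j).1,
    ⟨fun j => (h j).2.1, fun j => (h j).2.2.1⟩, hr⟩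

theorem mem_schubertCell_iff {F : CompleteFlag n} {w : Equiv.Perm (Fin n)} :
    F ∈ schubertCell w ↔ ∃ u, F.IsAdapted u ∧ IsEchelon w u := by
  have key : ∀ (c : Fin n → Fin n → ℂ) (j b : Fin n), ((Pi.single (w j) 1 : Fin n → ℂ) +
      ∑ b ∈ Finset.Ioi (w j), c (w j) b • (Pi.single b 1 : Fin n → ℂ)) b =
      if b = w j then 1 else if w j < b then c (w j) b else 0 := by
    intro c j b
    simp only [Pi.add_apply, Finset.sum_apply, Pi.smul_apply, Pi.single_apply, smul_eq_mul,
      mul_ite, mul_one, mul_zero, Finset.sum_ite_eq, Finset.mem_Ioi]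
    by_cases h : b = w j
    · simp [h]
    · simp [h]
  constructor
  · rintro ⟨c, hc⟩
    refine ⟨_, hc, fun j => ?_, fun j b hb => ?_⟩
    · simp only [key, if_true]
    · simp only [key, hb.ne, hb.not_gt, if_false]
  · rintro ⟨u, hF, hu⟩
    -- `schubertCell` indexes coefficients by pivots, not by positions in the basis.
    refine ⟨fun a => u (w.symm a), fun i => ?_⟩
    rw [hF i]
    congr 2
    funext j b
    refine Eq.trans ?_ (key (fun a => u (w.symm a)) j b).symm
    rw [Equiv.symm_apply_apply]
    split_ifs with h1 h2
    · rw [h1, hu.pivot]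
    · rfl
    · exact hu.eq_zero j b (lt_of_le_of_ne (not_lt.1 h2) h1)

/-! ### Charts and Cramer's rule. -/

/-- The open translate of the big cell: the flags with an adapted basis that is reduced with
respect to `w`. -/
def chart (w : Equiv.Perm (Fin n)) : Set (CompleteFlag n) :=
  {F | ∃ u, F.IsAdapted u ∧ PivotReduced w u}

/-- The matrix whose invertibility says that `V_i` projects isomorphically to the coordinates
`w i, …, w (n - 1)`. -/
def chartMatrix (w : Equiv.Perm (Fin n)) (u : Fin n → Fin n → ℂ) (i : Fin n) :
    Matrix (Fin n) (Fin n) ℂ :=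
  Matrix.of fun k j => if k < i ∨ j < i then (if k = j then 1 else 0) else u j (w k)

/-- The identity block on indices below `i` keeps every matrix of size `n`; it forces solutions of
the systems below to vanish there, so only the block of indices from `i` on matters. -/
theorem chartMatrix_mulVec_of_lt (w : Equiv.Perm (Fin n)) (u : Fin n → Fin n → ℂ) {i k : Fin n}
    (y : Fin n → ℂ) (hk : k < i) : (chartMatrix w u i).mulVec y k = y k := by
  simp [chartMatrix, Matrix.mulVec, dotProduct, hk]

theorem chartMatrix_mulVec_of_le (w : Equiv.Perm (Fin n)) (u : Fin n → Fin n → ℂ) {i k : Fin n}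
    (y : Fin n → ℂ) (hy : ∀ j < i, y j = 0) (hk : i ≤ k) :
    (chartMatrix w u i).mulVec y k = (∑ j, y j • u j) (w k) := by
  simp only [chartMatrix, Matrix.mulVec, dotProduct, Matrix.of_apply, Finset.sum_apply,
    Pi.smul_apply, smul_eq_mul]
  refine Finset.sum_congr rfl fun j _ => ?_
  by_cases hj : j < i
  · simp [hy j hj]
  · simp [hj, hk.not_gt, mul_comm]

theorem det_chartMatrix_ne_zero {w : Equiv.Perm (Fin n)} {u : Fin n → Fin n → ℂ} {i : Fin n}
    (h : ∀ y : Fin n → ℂ, (∀ j < i, y j = 0) → (∀ k, i ≤ k → (∑ j, y j • u j) (w k) = 0) →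
      y = 0) : (chartMatrix w u i).det ≠ 0 := by
  intro hdet
  obtain ⟨y, hy0, hy⟩ := Matrix.exists_mulVec_eq_zero_iff.2 hdet
  have hlt : ∀ j < i, y j = 0 := fun j hj => by
    rw [← chartMatrix_mulVec_of_lt w u y hj, hy, Pi.zero_apply]
  refine hy0 (h y hlt fun k hk => ?_)
  rw [← chartMatrix_mulVec_of_le w u y hlt hk, hy, Pi.zero_apply]

/-- The `i`-th vector of the reduced basis, as a combination of `u` given by Cramer's rule. -/
noncomputable def reducedVector (w : Equiv.Perm (Fin n)) (u : Fin n → Fin n → ℂ)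
    (i b : Fin n) : ℂ :=
  (∑ j, (chartMatrix w u i).adjugate j i * u j b) / (chartMatrix w u i).det

/-- Column `i` of the inverse of `chartMatrix w u i` solves `H y = e_i`: the identity rows kill `y`
below `i`, and the other rows prescribe the entries at the pivots. -/
theorem reducedVector_spec {w : Equiv.Perm (Fin n)} {u : Fin n → Fin n → ℂ} {i : Fin n}
    (h : (chartMatrix w u i).det ≠ 0) :
    reducedVector w u i ∈ Submodule.span ℂ (u '' Set.Ici i) ∧
      ∀ k, i ≤ k → reducedVector w u i (w k) = if k = i then 1 else 0 := by
  set H := chartMatrix w u i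
  set y : Fin n → ℂ := fun j => H.det⁻¹ * H.adjugate j i
  have hyH : H.mulVec y = Pi.single i 1 := by
    have : y = (H.det⁻¹ • H.adjugate).mulVec (Pi.single i 1) := by
      ext j; simp [y, Matrix.mulVec_single]
    rw [this, Matrix.mulVec_mulVec, Matrix.mul_smul, Matrix.mul_adjugate, smul_smul,
      inv_mul_cancel₀ h, one_smul, Matrix.one_mulVec]
  have hlt : ∀ j < i, y j = 0 := fun j hj => by
    rw [← chartMatrix_mulVec_of_lt w u y hj, hyH, Pi.single_eq_of_ne hj.ne]
  have hsum : reducedVector w u i = ∑ j, y j • u j := by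
    ext b
    simp only [reducedVector, y, Finset.sum_apply, Pi.smul_apply, smul_eq_mul, Finset.sum_div]
    refine Finset.sum_congr rfl fun j _ => ?_
    change _ / H.det = _
    ring
  refine ⟨mem_span_image_Ici_iff.2 ⟨y, hlt, hsum.symm⟩, fun k hk => ?_⟩
  rw [hsum, ← chartMatrix_mulVec_of_le w u y hlt hk, hyH, Pi.single_apply]

theorem IsAdapted.reducedVector {F : CompleteFlag n} {w : Equiv.Perm (Fin n)}
    {u : Fin n → Fin n → ℂ} (hF : F.IsAdapted u) (h : ∀ i, (chartMatrix w u i).det ≠ 0) :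
    F.IsAdapted (reducedVector w u) ∧ PivotReduced w (CompleteFlag.reducedVector w u) := by
  have hr : PivotReduced w (CompleteFlag.reducedVector w u) :=
    ⟨fun j => by simpa using (reducedVector_spec (h j)).2 j le_rfl,
      fun j k hk => by simpa [hk.ne'] using (reducedVector_spec (h j)).2 k hk.le⟩
  refine ⟨isAdapted_of_linearIndependent hr.linearIndependent fun j => ?_, hr⟩
  rw [hF j]
  exact (reducedVector_spec (h j)).1

/-- Any adapted basis detects the chart through nonvanishing determinants; applied to the columns of
a matrix, this makes the chart open. -/
theorem IsAdapted.mem_chart_iff {F : CompleteFlag n} {w : Equiv.Perm (Fin n)}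
    {u : Fin n → Fin n → ℂ} (hF : F.IsAdapted u) (hu : LinearIndependent ℂ u) :
    F ∈ chart w ↔ ∀ i, (chartMatrix w u i).det ≠ 0 := by
  refine ⟨?_, fun h => ⟨_, hF.reducedVector h⟩⟩
  rintro ⟨v, hv, hr⟩ i
  refine det_chartMatrix_ne_zero fun y hy h0 => ?_
  have hz : ∑ j, y j • u j = 0 := by
    refine hr.eq_zero_of_mem_span (i := i) ?_ h0
    rw [← hv i, hF i]
    exact mem_span_image_Ici_iff.2 ⟨y, hy, rfl⟩
  exact funext (Fintype.linearIndependent_iff.1 hu y hz)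

theorem schubertCell_subset_chart (w : Equiv.Perm (Fin n)) : schubertCell w ⊆ chart w := by
  intro F hF
  obtain ⟨u, hF, hu⟩ := mem_schubertCell_iff.1 hF
  refine (hF.mem_chart_iff hu.linearIndependent).2 fun i => det_chartMatrix_ne_zero ?_
  exact fun y hy h0 => funext (hu.coeff_eq_zero fun k => (lt_or_ge k i).imp (hy k) (h0 k))

/-! ### Comparing cells and charts. -/

/-- The sum of the pivots of `V_i`. -/
def pivotSum (w : Equiv.Perm (Fin n)) (i : Fin n) : ℕ :=
  ∑ j, if i ≤ j then (w j : ℕ) else 0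

/-- Consecutive sums differ by a single pivot, so the pivots are recovered from the last one
backwards. -/
theorem pivotSum_injective : Function.Injective (pivotSum (n := n)) := by
  intro w w' h
  have key : ∀ i : ℕ, ∀ j : Fin n, n ≤ i + j → w j = w' j := by
    intro i
    induction i with
    | zero => exact fun j hj => absurd j.2 (by omega)
    | succ i ih =>
      intro j hj
      have h1 := congrFun h j
      unfold pivotSum at h1
      rw [← Finset.add_sum_erase _ _ (Finset.mem_univ j),
        ← Finset.add_sum_erase (a := j) (f := fun k => if j ≤ k then (w' k : ℕ) else 0) _
          (Finset.mem_univ j)] at h1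
      have h2 : ∀ k ∈ Finset.univ.erase j,
          (if j ≤ k then (w k : ℕ) else 0) = if j ≤ k then (w' k : ℕ) else 0 := by
        intro k hk
        split_ifs with hjk
        · have : (j : ℕ) < k := lt_of_le_of_ne (α := Fin n) hjk (Finset.ne_of_mem_erase hk).symm
          rw [ih k (by omega)]
        · rfl
      rw [Finset.sum_congr rfl h2] at h1
      simpa [Fin.ext_iff] using h1
  exact Equiv.ext fun j => key n j (by omega)

/-- A nonzero determinant has a nonzero term, given by some `σ`. The identity block makes `σ`
preserve the indices from `i` on. There `u k` is nonzero at `w (σ k)`, whence `w' k ≤ w (σ k)`, and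
summation gives the bound. -/
theorem pivotSum_le {F : CompleteFlag n} {w w' : Equiv.Perm (Fin n)} (hF : F ∈ schubertCell w')
    (hF' : F ∈ chart w) (i : Fin n) : pivotSum w' i ≤ pivotSum w i := by
  obtain ⟨u, hF, hu⟩ := mem_schubertCell_iff.1 hF
  have hdet := (hF.mem_chart_iff hu.linearIndependent).1 hF' i
  rw [Matrix.det_apply] at hdet
  obtain ⟨σ, -, hσ⟩ := Finset.exists_ne_zero_of_sum_ne_zero hdet
  have hσ : ∀ k, chartMatrix w u i (σ k) k ≠ 0 := by
    intro k h0
    apply hσ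
    have h1 : ∏ j, chartMatrix w u i (σ j) j = 0 := Finset.prod_eq_zero (Finset.mem_univ k) h0
    rw [h1, smul_zero]
  have hfix : ∀ k, k < i → σ k = k := by
    intro k hk
    by_contra hne
    exact hσ k (by simp [chartMatrix, hk, hne])
  have hiff : ∀ k, i ≤ σ k ↔ i ≤ k := by
    intro k
    rw [← not_lt, ← not_lt, not_iff_not]
    refine ⟨fun h => ?_, fun h => by rwa [hfix k h]⟩
    have := σ.injective (hfix _ h)
    rwa [← this]
  unfold pivotSum
  rw [← Equiv.sum_comp σ fun j => if i ≤ j then (w j : ℕ) else 0]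
  refine Finset.sum_le_sum fun k _ => ?_
  simp only [hiff]
  split_ifs with hk
  · by_contra hlt
    apply hσ k
    have h1 : ¬ (σ k < i) := not_lt.2 ((hiff k).2 hk)
    simp only [chartMatrix, Matrix.of_apply, h1, hk.not_gt, or_self, if_false]
    exact hu.eq_zero k _ (not_le.1 hlt)
  · exact le_rfl

/-- A statistic that strictly decreases when a chart is left for another cell that meets it. -/
def cellHeight (w : Equiv.Perm (Fin n)) : ℕ :=
  ∑ i, pivotSum w i

theorem cellHeight_lt {F : CompleteFlag n} {w w' : Equiv.Perm (Fin n)} (hF : F ∈ schubertCell w')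
    (hF' : F ∈ chart w) (hne : w' ≠ w) : cellHeight w' < cellHeight w := by
  refine Finset.sum_lt_sum (fun i _ => pivotSum_le hF hF' i) ?_
  by_contra hcon
  push Not at hcon
  refine hne (pivotSum_injective (funext fun i => ?_))
  exact le_antisymm (pivotSum_le hF hF' i) (hcon i (Finset.mem_univ i))

/-- Each cell lies in its own chart, so for two distinct cells with a common flag each height would
be smaller than the other. -/
theorem schubertCell_unique {F : CompleteFlag n} {w w' : Equiv.Perm (Fin n)}
    (hF : F ∈ schubertCell w) (hF' : F ∈ schubertCell w') : w = w' := by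
  by_contra hne
  exact lt_asymm (cellHeight_lt hF (schubertCell_subset_chart _ hF') hne)
    (cellHeight_lt hF' (schubertCell_subset_chart _ hF) (Ne.symm hne))

theorem exists_mem_schubertCell (F : CompleteFlag n) : ∃ w, F ∈ schubertCell w := by
  obtain ⟨w, u, h1, h2, -⟩ := F.exists_echelon_reduced
  exact ⟨w, mem_schubertCell_iff.2 ⟨u, h1, h2⟩⟩

theorem exists_echelon_of_mem_schubertCell {F : CompleteFlag n} {w : Equiv.Perm (Fin n)}
    (hF : F ∈ schubertCell w) : ∃ u, F.IsAdapted u ∧ IsEchelon w u ∧ PivotReduced w u := by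
  obtain ⟨w', u, h1, h2, h3⟩ := F.exists_echelon_reduced
  obtain rfl := schubertCell_unique hF (mem_schubertCell_iff.2 ⟨u, h1, h2⟩)
  exact ⟨u, h1, h2, h3⟩

end CompleteFlag

/-! ### The shift operator on echelon bases. -/

section Springer

variable {n m : ℕ}

theorem shiftOperator_apply (x : Fin n → ℂ) (b : Fin n) :
    shiftOperator n m x b = if h : m ≤ (b : ℕ) then x ⟨b - m, by omega⟩ else 0 := by
  simp only [shiftOperator, Module.Basis.constr_apply_fintype, Finset.sum_apply, Pi.smul_apply,
    smul_eq_mul, Pi.basisFun_equivFun, LinearEquiv.refl_apply]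
  split_ifs with h
  · rw [Finset.sum_eq_single ⟨b - m, by omega⟩]
    · have h1 : (b : ℕ) - m + m < n := by omega
      have h2 : (⟨(b : ℕ) - m + m, h1⟩ : Fin n) = b := Fin.ext (by simp only; omega)
      simp [h1, h2]
    · intro i _ hi
      split_ifs with him
      · rw [Pi.single_eq_of_ne, mul_zero]
        rintro rfl
        exact hi (Fin.ext (by simp))
      · simp
    · simp
  · refine Finset.sum_eq_zero fun i _ => ?_
    split_ifs with him
    · rw [Pi.single_eq_of_ne, mul_zero]
      rintro rfl
      exact h (by simp)
    · simp

theorem shiftOperator_apply_of_lt (x : Fin n → ℂ) {b : Fin n} (h : (b : ℕ) < m) :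
    shiftOperator n m x b = 0 := by
  rw [shiftOperator_apply, dif_neg (not_le.2 h)]

theorem shiftOperator_apply_of_eq_add (x : Fin n → ℂ) {a b : Fin n} (h : (b : ℕ) = a + m) :
    shiftOperator n m x b = x a := by
  rw [shiftOperator_apply, dif_pos (by omega)]
  congr
  omega

theorem shiftOperator_cases (b : Fin n) : (b : ℕ) < m ∨ ∃ a : Fin n, (b : ℕ) = a + m := by
  rcases lt_or_ge (b : ℕ) m with h | h
  · exact Or.inl h
  · exact Or.inr ⟨⟨b - m, by omega⟩, by simp only; omega⟩

theorem CompleteFlag.IsAdapted.mem_springerFiber_iff {F : CompleteFlag n}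
    {u : Fin n → Fin n → ℂ} (hF : F.IsAdapted u) (T : (Fin n → ℂ) →ₗ[ℂ] (Fin n → ℂ)) :
    F ∈ springerFiber T ↔ ∀ j, T (u j) ∈ F.sub j := by
  constructor
  · exact fun h j => h j (Submodule.mem_map_of_mem (hF.mem le_rfl))
  · intro h i
    rw [hF i, Submodule.map_span, Submodule.span_le]
    rintro _ ⟨_, ⟨j, hj, rfl⟩, rfl⟩
    rw [← hF i]
    exact F.antitone_sub hj (h j)

/-- A cell that meets the Springer fiber of the shift operator belongs to a restricted
permutation. -/
theorem isRestricted_of_mem (hm : 0 < m) {F : CompleteFlag n} {w : Equiv.Perm (Fin n)}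
    (hF : F ∈ springerFiber (shiftOperator n m)) (hw : F ∈ schubertCell w) :
    IsRestricted m w := by
  obtain ⟨u, hu, he⟩ := CompleteFlag.mem_schubertCell_iff.1 hw
  intro x y hxy
  obtain ⟨j, rfl⟩ := w.surjective x
  obtain ⟨k, rfl⟩ := w.surjective y
  have hmem := (hu.mem_springerFiber_iff _).1 hF j
  have hval : shiftOperator n m (u j) (w k) = 1 := by
    rw [shiftOperator_apply_of_eq_add _ hxy, he.pivot]
  rw [hu j] at hmem
  -- `N (u j)` starts at `w k = w j + m`, and its starting position must be a pivot of `V_j`; hence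
  -- `l = k` and `j ≤ k`.
  obtain ⟨l, hl, hlx, hlt⟩ := he.exists_leading hmem fun h0 => by simp [h0] at hval
  have hlk : l = k := by
    apply w.injective
    apply le_antisymm
    · by_contra hlt'
      rw [hlt _ (not_le.1 hlt')] at hval
      exact zero_ne_one hval
    · by_contra hlt'
      have hlt' : (w l : ℕ) < w k := not_le.1 hlt'
      apply hlx
      rcases shiftOperator_cases (m := m) (w l) with h | ⟨a, ha⟩
      · exact shiftOperator_apply_of_lt _ h
      · rw [shiftOperator_apply_of_eq_add _ ha]
        exact he.eq_zero _ _ (Fin.lt_def.2 (by omega))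
  subst hlk
  simp only [Equiv.Perm.coe_inv, Equiv.symm_apply_apply]
  refine lt_of_le_of_ne hl ?_
  rintro rfl
  omega

/-- The pairs `(α, β)` whose coordinate parametrizes the Springer cell of `w`. -/
def IsFreePair (m : ℕ) (w : Equiv.Perm (Fin n)) (p : Fin n × Fin n) : Prop :=
  p.1 < p.2 ∧ w⁻¹ p.2 < w⁻¹ p.1 ∧ ∀ c : Fin n, (c : ℕ) = p.2 + m → w⁻¹ p.1 < w⁻¹ c

open CompleteFlag in
/-- A point of a Springer cell is determined by its free coordinates. -/
theorem eq_of_free_coordinates (hm : 0 < m) {w : Equiv.Perm (Fin n)} {F F' : CompleteFlag n}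
    {u u' : Fin n → Fin n → ℂ}
    (hF : F.IsAdapted u) (hu : IsEchelon w u) (hr : PivotReduced w u)
    (hF' : F'.IsAdapted u') (hu' : IsEchelon w u') (hr' : PivotReduced w u')
    (hT : F ∈ springerFiber (shiftOperator n m)) (hT' : F' ∈ springerFiber (shiftOperator n m))
    (h : ∀ p, IsFreePair m w p → u (w⁻¹ p.1) p.2 = u' (w⁻¹ p.1) p.2) : u = u' := by
  -- `N` moves the leading entry past `w j`, so `u j` itself does not contribute to `N (u j)`.
  have strict : ∀ {F : CompleteFlag n} {u : Fin n → Fin n → ℂ}, F.IsAdapted u → IsEchelon w u →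
      F ∈ springerFiber (shiftOperator n m) → ∀ j, shiftOperator n m (u j) ∈
        Submodule.span ℂ (u '' Set.Ioi j) := by
    intro F u hF hu hT j
    refine hu.mem_span_Ioi ?_ fun b hb => ?_
    · rw [← hF j]
      exact (hF.mem_springerFiber_iff _).1 hT j
    · have hb : (b : ℕ) ≤ w j := hb
      rcases shiftOperator_cases (m := m) b with hbm | ⟨a, ha⟩
      · exact shiftOperator_apply_of_lt _ hbm
      · rw [shiftOperator_apply_of_eq_add _ ha]
        exact hu.eq_zero _ _ (Fin.lt_def.2 (by omega))
  have key : ∀ i : ℕ, ∀ j : Fin n, n ≤ i + j → u j = u' j := by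
    intro i
    induction i with
    | zero => exact fun j hj => absurd j.2 (by omega)
    | succ i ih =>
      intro j hj
      rw [← sub_eq_zero]
      have him : u' '' Set.Ioi j = u '' Set.Ioi j := by
        refine Set.image_congr fun k hk => (ih k ?_).symm
        have : (j : ℕ) < k := hk
        omega
      -- At an unforced position, both vectors have the same entry: it lies before the pivot, at it,
      -- at a later pivot, or is free.
      have h0 : ∀ b : Fin n, (∀ c : Fin n, (c : ℕ) = b + m → j < w⁻¹ c) → (u j - u' j) b = 0 := by
        intro b hb
        obtain ⟨k, rfl⟩ := w.surjective b
        rw [Pi.sub_apply, sub_eq_zero]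
        rcases lt_trichotomy (w k) (w j) with hlt | heq | hgt
        · rw [hu.eq_zero _ _ hlt, hu'.eq_zero _ _ hlt]
        · rw [heq, hu.pivot, hu'.pivot]
        · rcases lt_trichotomy k j with hkj | rfl | hkj
          · simpa using h (w j, w k) ⟨hgt, by simpa using hkj, by simpa using hb⟩
          · exact absurd hgt (lt_irrefl _)
          · rw [hr.eq_zero _ _ hkj, hr'.eq_zero _ _ hkj]
      -- `N` of the difference lies in the span of the later vectors, and its entries at their
      -- pivots come from unforced positions, so it is zero.
      have hN : shiftOperator n m (u j - u' j) = 0 := by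
        have hmem : shiftOperator n m (u j - u' j) ∈ Submodule.span ℂ (u '' Set.Ioi j) := by
          rw [map_sub]
          refine Submodule.sub_mem _ (strict hF hu hT j) ?_
          rw [← him]
          exact strict hF' hu' hT' j
        refine hr.eq_zero_of_mem_span
          (Submodule.span_mono (Set.image_mono Set.Ioi_subset_Ici_self) hmem) fun k hk => ?_
        rcases shiftOperator_cases (m := m) (w k) with hkm | ⟨a, ha⟩
        · exact shiftOperator_apply_of_lt _ hkm
        rw [shiftOperator_apply_of_eq_add _ ha]
        rcases hk.eq_or_lt with rfl | hk
        · have haw : a < w j := Fin.lt_def.2 (by omega)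
          rw [Pi.sub_apply, hu.eq_zero _ _ haw, hu'.eq_zero _ _ haw, sub_zero]
        · refine h0 a fun c hc => ?_
          rw [Fin.ext (hc.trans ha.symm)]
          simpa using hk
      funext b
      by_cases hb : (b : ℕ) + m < n
      · rw [← shiftOperator_apply_of_eq_add (m := m) (u j - u' j) (b := ⟨b + m, hb⟩) rfl, hN]
        rfl
      · exact h0 b fun c hc => by omega
  exact funext fun j => key n j (by omega)

theorem shiftOperator_mem {Y : Type} (A : Subalgebra ℂ (Y → ℂ)) {f : Y → Fin n → ℂ}
    (hf : ∀ b, (fun y => f y b) ∈ A) (b : Fin n) :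
    (fun y => shiftOperator n m (f y) b) ∈ A := by
  rcases shiftOperator_cases (m := m) b with hb | ⟨a, ha⟩
  · simp only [shiftOperator_apply_of_lt _ hb]
    exact A.zero_mem
  · simp only [shiftOperator_apply_of_eq_add _ ha]
    exact hf a

open Classical in
-- Descending construction, with the last `i` vectors available. `π y x` is the vector of their span
-- with the same entries as `x` at their pivots; carrying it along turns the stability condition on
-- the next vector into an explicit formula. Keeping all entries in a subalgebra `A` records regular
-- dependence on the parameter.
theorem exists_partial_parametrization {w : Equiv.Perm (Fin n)}
    (hw : IsRestricted m w) {Y : Type} (A : Subalgebra ℂ (Y → ℂ)) (a : Fin n × Fin n → Y → ℂ)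
    (ha : ∀ p, a p ∈ A) (i : ℕ) :
    ∃ (u : Fin n → Y → Fin n → ℂ) (π : Y → (Fin n → ℂ) → (Fin n → ℂ)),
      (∀ x : Y → Fin n → ℂ, (∀ b, (fun y => x y b) ∈ A) → ∀ b, (fun y => π y (x y) b) ∈ A) ∧
      (∀ y x, π y x ∈ Submodule.span ℂ ((fun j => u j y) '' {k : Fin n | n ≤ i + k})) ∧
      (∀ y x (k : Fin n), n ≤ i + k → π y x (w k) = x (w k)) ∧
      (∀ y x (c : Fin n), (∀ b ≤ c, x b = 0) → π y x c = 0) ∧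
      ∀ j : Fin n, n ≤ i + j →
        (∀ b, (fun y => u j y b) ∈ A) ∧ ∀ y, u j y (w j) = 1 ∧ (∀ b < w j, u j y b = 0) ∧
          (∀ k, j < k → u j y (w k) = 0) ∧
          shiftOperator n m (u j y) ∈ Submodule.span ℂ ((fun j => u j y) '' Set.Ioi j) ∧
          ∀ b, IsFreePair m w (w j, b) → u j y b = a (w j, b) y := by
  induction i with
  | zero =>
    refine ⟨fun _ _ => 0, fun _ _ => 0, fun _ _ _ => A.zero_mem, fun _ _ => Submodule.zero_mem _,
      fun _ _ k hk => absurd k.2 (by omega), fun _ _ _ _ => rfl,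
      fun k hk => absurd k.2 (by omega)⟩
  | succ i ih =>
    obtain ⟨u, π, hA, hspan, hpiv, hlow, hu⟩ := ih
    by_cases hi : i < n
    swap
    · refine ⟨u, π, hA, fun y x => Submodule.span_mono (Set.image_mono ?_) (hspan y x),
        fun y x k _ => hpiv y x k (by omega), hlow, fun j _ => hu j (by omega)⟩
      intro k hk
      simp only [Set.mem_ofPred_eq] at hk ⊢
      omega
    set j₀ : Fin n := ⟨n - 1 - i, by omega⟩ with hj₀
    have hval : (j₀ : ℕ) = n - 1 - i := rfl
    have hproc : ∀ k : Fin n, n ≤ i + k ↔ j₀ < k := fun k => by rw [Fin.lt_def]; omega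
    have hset : {k : Fin n | n ≤ i + k} = Set.Ioi j₀ := Set.ext fun k => by simp [hproc]
    rw [hset] at hspan
    simp only [hproc] at hpiv hu
    have hproc' : ∀ k : Fin n, n ≤ i + 1 + k ↔ j₀ ≤ k := fun k => by rw [Fin.le_def]; omega
    have hset' : {k : Fin n | n ≤ i + 1 + k} = Set.Ici j₀ := Set.ext fun k => by simp [hproc']
    rw [hset']
    simp only [hproc']
    clear_value j₀
    clear hval hproc hproc' hset hset' hi i hj₀
    have hres : ∀ x y : Fin n, (y : ℕ) = x + m → w⁻¹ x < w⁻¹ y := hw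
    -- `f` holds the pivot and the free entries; `v` adds the forced ones. The formula for `v` uses
    -- `N f`, which agrees with `N v` at the later pivots.
    let f : Y → Fin n → ℂ := fun y b =>
      if b = w j₀ then 1 else if IsFreePair m w (w j₀, b) then a (w j₀, b) y else 0
    let v : Y → Fin n → ℂ := fun y b => f y b +
      if h : ∃ c : Fin n, (c : ℕ) = b + m ∧ w⁻¹ c ≤ j₀ then
        π y (shiftOperator n m (f y)) h.choose else 0
    have hfA : ∀ b, (fun y => f y b) ∈ A := by
      intro b
      simp only [f]
      split_ifs
      · exact A.one_mem
      · exact ha _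
      · exact A.zero_mem
    have hvA : ∀ b, (fun y => v y b) ∈ A := by
      intro b
      refine A.add_mem (hfA b) ?_
      split_ifs with h
      · exact hA _ (shiftOperator_mem A hfA) _
      · exact A.zero_mem
    have hv_of_lt : ∀ y (b : Fin n), (∀ c : Fin n, (c : ℕ) = b + m → j₀ < w⁻¹ c) → v y b = f y b := by
      intro y b h
      simp only [v]
      rw [dif_neg, add_zero]
      rintro ⟨c, hc, hle⟩
      exact absurd (h c hc) (not_lt.2 hle)
    have hv_of_le : ∀ y (b c : Fin n), (c : ℕ) = b + m → w⁻¹ c ≤ j₀ →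
        v y b = f y b + π y (shiftOperator n m (f y)) c := by
      intro y b c hc hle
      have h : ∃ c : Fin n, (c : ℕ) = b + m ∧ w⁻¹ c ≤ j₀ := ⟨c, hc, hle⟩
      simp only [v]
      rw [dif_pos h, show h.choose = c from Fin.ext (h.choose_spec.1.trans hc.symm)]
    have hf_lt : ∀ y b, b < w j₀ → f y b = 0 := by
      intro y b hb
      simp only [f]
      rw [if_neg hb.ne, if_neg]
      exact fun h => lt_asymm hb h.1
    have hf_next : ∀ y b, j₀ < w⁻¹ b → f y b = 0 := by
      intro y b hb
      simp only [f]
      rw [if_neg, if_neg]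
      · intro h
        have := h.2.1
        simp only [Equiv.Perm.coe_inv, Equiv.symm_apply_apply] at this
        exact lt_asymm hb this
      · rintro rfl
        simp at hb
    -- `N f` vanishes before `w j₀ + m`, and `π` creates no earlier entry.
    have hpf : ∀ y (b c : Fin n), (c : ℕ) = b + m → b < w j₀ →
        π y (shiftOperator n m (f y)) c = 0 := by
      intro y b c hc hb
      refine hlow y _ c fun d hd => ?_
      rcases shiftOperator_cases (m := m) d with hdm | ⟨e, he⟩
      · exact shiftOperator_apply_of_lt _ hdm
      · rw [shiftOperator_apply_of_eq_add _ he]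
        apply hf_lt
        rw [Fin.lt_def] at hb ⊢
        rw [Fin.le_def] at hd
        omega
    have hv_lt : ∀ y b, b < w j₀ → v y b = 0 := by
      intro y b hb
      by_cases h : ∃ c : Fin n, (c : ℕ) = b + m ∧ w⁻¹ c ≤ j₀
      · obtain ⟨c, hc, hle⟩ := h
        rw [hv_of_le y b c hc hle, hf_lt y b hb, hpf y b c hc hb, add_zero]
      · push Not at h
        rw [hv_of_lt y b h, hf_lt y b hb]
    -- Restrictedness enters here: shifting this pivot or a later one by `m` gives a still later
    -- pivot, so no correction disturbs these entries.
    have hv_pivot : ∀ y, v y (w j₀) = 1 := by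
      intro y
      rw [hv_of_lt]
      · simp [f]
      · intro c hc
        simpa using hres _ c hc
    have hv_next : ∀ y k, j₀ < k → v y (w k) = 0 := by
      intro y k hk
      rw [hv_of_lt, hf_next]
      · simpa using hk
      · intro c hc
        exact hk.trans (by simpa using hres _ c hc)
    have hv_free : ∀ y b, IsFreePair m w (w j₀, b) → v y b = a (w j₀, b) y := by
      intro y b hb
      rw [hv_of_lt]
      · simp only [f]
        rw [if_neg hb.1.ne', if_pos hb]
      · intro c hc
        simpa using hb.2.2 c hc
    have hTv : ∀ y, shiftOperator n m (v y) = π y (shiftOperator n m (f y)) := by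
      intro y
      funext c
      rcases shiftOperator_cases (m := m) c with hcm | ⟨b, hb⟩
      · rw [shiftOperator_apply_of_lt _ hcm, hlow]
        intro d hd
        exact shiftOperator_apply_of_lt _ (lt_of_le_of_lt hd hcm)
      · rw [shiftOperator_apply_of_eq_add _ hb]
        rcases lt_or_ge j₀ (w⁻¹ c) with hlt | hle
        · have h1 := hpiv y (shiftOperator n m (f y)) _ hlt
          simp only [Equiv.Perm.coe_inv, Equiv.apply_symm_apply] at h1
          rw [h1, shiftOperator_apply_of_eq_add _ hb, hv_of_lt]
          intro d hd
          rwa [Fin.ext (hd.trans hb.symm)]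
        · rw [hv_of_le y b c hb hle]
          -- The position `b` is neither the pivot nor free, so the entry of `v` is the correction
          -- alone.
          have hbj : w⁻¹ b < j₀ := (hres b c hb).trans_le hle
          have hf0 : f y b = 0 := by
            simp only [f]
            rw [if_neg, if_neg]
            · intro h
              have := h.2.2 c hb
              simp only [Equiv.Perm.coe_inv, Equiv.symm_apply_apply] at this
              exact absurd this (not_lt.2 hle)
            · rintro rfl
              simp at hbj
          rw [hf0, zero_add]
    have himg : ∀ y s, s ⊆ Set.Ioi j₀ →
        (fun j => Function.update u j₀ v j y) '' s = (fun j => u j y) '' s := by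
      intro y s hs
      refine Set.image_congr fun k hk => ?_
      have : k ≠ j₀ := (hs hk).ne'
      simp only [Function.update_of_ne this]
    -- The new `π` repairs the entry at `w j₀` by a multiple of `v`, which vanishes at the later
    -- pivots and leaves them intact.
    refine ⟨Function.update u j₀ v, fun y x => π y x + (x (w j₀) - π y x (w j₀)) • v y,
      ?_, ?_, ?_, ?_, ?_⟩
    · intro x hx b
      exact A.add_mem (hA x hx b) (A.mul_mem (A.sub_mem (hx _) (hA x hx _)) (hvA b))
    · intro y x
      refine Submodule.add_mem _ ?_ (Submodule.smul_mem _ _ (Submodule.subset_span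
        ⟨j₀, le_refl j₀, by simp⟩))
      have h1 := hspan y x
      rw [← himg y _ le_rfl] at h1
      exact Submodule.span_mono (Set.image_mono Set.Ioi_subset_Ici_self) h1
    · intro y x k hk
      rcases hk.eq_or_lt with rfl | hk
      · simp [hv_pivot]
      · simp [hv_next y k hk, hpiv y x k hk]
    · intro y x c hc
      simp only [Pi.add_apply, Pi.smul_apply, smul_eq_mul, hlow y x c hc, zero_add]
      rcases lt_or_ge c (w j₀) with hlt | hge
      · rw [hv_lt y c hlt, mul_zero]
      · rw [hc _ hge, hlow y x (w j₀) fun b hb => hc b (hb.trans hge), sub_zero, zero_mul]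
    · intro j hj
      rcases hj.eq_or_lt with rfl | hj
      · simp only [Function.update_self]
        refine ⟨hvA, fun y => ⟨hv_pivot y, hv_lt y, hv_next y, ?_, hv_free y⟩⟩
        rw [hTv y, himg y _ le_rfl]
        exact hspan y _
      · rw [Function.update_of_ne hj.ne']
        obtain ⟨h1, h2⟩ := hu j hj
        refine ⟨h1, fun y => ?_⟩
        rw [himg y _ (Set.Ioi_subset_Ioi hj.le)]
        exact h2 y

/-- The Springer cell of `w` is parametrized by its free coordinates. -/
theorem exists_parametrization {w : Equiv.Perm (Fin n)} (hw : IsRestricted m w) {Y : Type}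
    (A : Subalgebra ℂ (Y → ℂ)) (a : Fin n × Fin n → Y → ℂ) (ha : ∀ p, a p ∈ A) :
    ∃ u : Y → Fin n → Fin n → ℂ, (∀ j b, (fun y => u y j b) ∈ A) ∧ ∀ y,
      IsEchelon w (u y) ∧ PivotReduced w (u y) ∧
      (∀ j, shiftOperator n m (u y j) ∈ Submodule.span ℂ (u y '' Set.Ici j)) ∧
      ∀ p, IsFreePair m w p → u y (w⁻¹ p.1) p.2 = a p y := by
  obtain ⟨u, -, -, -, -, -, h⟩ := exists_partial_parametrization hw A a ha n
  replace h := fun j => h j (by omega)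
  refine ⟨fun y j => u j y, fun j => (h j).1, fun y => ⟨⟨fun j => ((h j).2 y).1,
    fun j => ((h j).2 y).2.1⟩, ⟨fun j => ((h j).2 y).1, fun j => ((h j).2 y).2.2.1⟩,
    fun j => ?_, fun p hp => ?_⟩⟩
  · exact Submodule.span_mono (Set.image_mono Set.Ioi_subset_Ici_self) ((h j).2 y).2.2.2.1
  · have := ((h (w⁻¹ p.1)).2 y).2.2.2.2 p.2
    simp only [Equiv.Perm.coe_inv, Equiv.apply_symm_apply] at this
    exact this hp

end Springer

/-! ### Counting the free coordinates. -/

section Counting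

variable {n m : ℕ} {w : Equiv.Perm (Fin n)}

theorem IsStable.le_of_eq_add_mul (hw : IsStable m w) {x y : Fin n} {t : ℕ}
    (h : (y : ℕ) = x + t * m) : w x ≤ w y := by
  induction t generalizing y with
  | zero => rw [Fin.ext (by simpa using h : (y : ℕ) = x)]
  | succ t ih =>
    rw [add_mul, one_mul, ← add_assoc] at h
    exact (ih (y := ⟨x + t * m, by omega⟩) rfl).trans (hw _ _ h).le

open Classical in
/-- The number of free coordinates of a Springer cell is the number of inversions of height
less than `m`. -/
theorem card_isFreePair (hm : 0 < m) (hw : IsRestricted m w) :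
    (Finset.univ.filter (IsFreePair m w)).card = inversionsBelow m w⁻¹ := by
  have hchain : ∀ (x y : Fin n) (t : ℕ), (y : ℕ) = x + t * m → w⁻¹ x ≤ w⁻¹ y :=
    fun x y t h => IsStable.le_of_eq_add_mul hw h
  have hlt : ∀ p : Fin n × Fin n, p.1 < p.2 →
      (p.1 : ℕ) + 1 + ((p.2 : ℕ) - p.1 - 1) % m < n := by
    intro p hp
    have := Nat.mod_le ((p.2 : ℕ) - p.1 - 1) m
    rw [Fin.lt_def] at hp
    omega
  -- Fix `α` and a residue class modulo `m`. Since `w⁻¹` increases along the class, the `β > α` in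
  -- it that are inverted with `α` form an initial segment. A free pair marks its last element and
  -- an inversion of height less than `m` its first; the map sends last to first.
  refine Finset.card_bij
    (fun p hp => (p.1, ⟨_, hlt p (Finset.mem_filter.1 hp).2.1⟩)) ?_ ?_ ?_
  · intro p hp
    obtain ⟨h1, h2, h3⟩ := (Finset.mem_filter.1 hp).2
    rw [Fin.lt_def] at h1
    set d := (p.2 : ℕ) - p.1 - 1
    set b : Fin n := ⟨(p.1 : ℕ) + 1 + d % m, hlt p h1⟩
    have hb : (b : ℕ) = (p.1 : ℕ) + 1 + d % m := rfl
    have hdm := Nat.mod_add_div' d m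
    have hmod := Nat.mod_lt d hm
    have hinv : w⁻¹ b < w⁻¹ p.1 := (hchain b p.2 (d / m) (by omega)).trans_lt h2
    simp only [Finset.mem_filter, Finset.mem_univ, true_and]
    refine ⟨Fin.lt_def.2 (by omega), hinv, ?_⟩
    -- The remainder only bounds the height by `m`; height exactly `m` contradicts restrictedness.
    by_contra hcon
    exact lt_asymm hinv (hw p.1 b (by omega))
  · rintro ⟨a, b⟩ hp ⟨a', b'⟩ hp' heq
    simp only [Prod.mk.injEq, Fin.mk.injEq] at heq
    obtain ⟨rfl, heq⟩ := heq
    -- If `b < b'` are in one class, then `b + m ≤ b'`, and freeness of `b` prevents `b'` from being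
    -- inverted with `a`.
    have key : ∀ b b' : Fin n, IsFreePair m w (a, b) → IsFreePair m w (a, b') →
        ((b : ℕ) - a - 1) % m = ((b' : ℕ) - a - 1) % m → ¬ b < b' := by
      intro b b' hb hb' hmod hbb'
      have h1 : (a : ℕ) < b := hb.1
      have h2 : (b : ℕ) < b' := hbb'
      have e1 := Nat.mod_add_div' ((b : ℕ) - a - 1) m
      have e2 := Nat.mod_add_div' ((b' : ℕ) - a - 1) m
      rw [hmod] at e1
      obtain ⟨t, ht⟩ : ∃ t, ((b' : ℕ) - a - 1) / m = ((b : ℕ) - a - 1) / m + t + 1 := by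
        have : ((b : ℕ) - a - 1) / m < ((b' : ℕ) - a - 1) / m :=
          Nat.lt_of_mul_lt_mul_right (a := m) (by omega)
        exact ⟨((b' : ℕ) - a - 1) / m - ((b : ℕ) - a - 1) / m - 1, by omega⟩
      rw [ht, add_mul, add_mul, one_mul] at e2
      have hc : (b : ℕ) + m < n := by omega
      have h3 := hb.2.2 ⟨b + m, hc⟩ rfl
      have h4 := hchain ⟨b + m, hc⟩ b' t (by simp only; omega)
      exact absurd hb'.2.1 (not_lt.2 (h3.le.trans h4))
    have hb := (Finset.mem_filter.1 hp).2
    have hb' := (Finset.mem_filter.1 hp').2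
    have hmod : ((b : ℕ) - a - 1) % m = ((b' : ℕ) - a - 1) % m := by omega
    rw [le_antisymm (not_lt.1 (key _ _ hb' hb hmod.symm)) (not_lt.1 (key _ _ hb hb' hmod))]
  · rintro ⟨a, b⟩ hp
    obtain ⟨h1, h2, h3⟩ := (Finset.mem_filter.1 hp).2
    simp only at h1 h2 h3
    rw [Fin.lt_def] at h1
    -- The preimage is found by moving up the class from `b` in steps of `m` as long as the
    -- inversion persists.
    set P : ℕ → Prop := fun t => ∃ c : Fin n, (c : ℕ) = b + t * m ∧ w⁻¹ c < w⁻¹ a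
    have hP0 : P 0 := ⟨b, by simp, h2⟩
    have hPle : ∀ t, P t → t ≤ n := by
      rintro t ⟨c, hc, -⟩
      have := Nat.le_mul_of_pos_right t hm
      omega
    obtain ⟨c, hc, hca⟩ : P (Nat.findGreatest P n) :=
      Nat.findGreatest_spec (m := 0) (Nat.zero_le n) hP0
    set t := Nat.findGreatest P n with ht
    have hnext : ¬ P (t + 1) := fun h =>
      absurd (Nat.le_findGreatest (hPle _ h) h) (by omega)
    refine ⟨(a, c), ?_, ?_⟩
    · simp only [Finset.mem_filter, Finset.mem_univ, true_and]
      refine ⟨Fin.lt_def.2 (by simp only; omega), hca, fun d hd => ?_⟩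
      have hd : (d : ℕ) = c + m := hd
      refine lt_of_le_of_ne (not_lt.1 fun hlt' => hnext ⟨d, ?_, hlt'⟩) fun he => ?_
      · rw [add_mul, one_mul]
        omega
      · have := (w⁻¹).injective he
        have : (a : ℕ) = d := congrArg Fin.val this
        omega
    · simp only [Prod.mk.injEq, true_and]
      refine Fin.ext ?_
      have h4 : (c : ℕ) - a - 1 = (b - a - 1) + t * m := by omega
      simp only [h4, Nat.add_mul_mod_self_right]
      rw [Nat.mod_eq_of_lt (by omega)]
      omega

end Counting

/-! ### Regularity on the flag variety, tested on `GL_n`. -/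

section Geometry

open SpaceWithFunctions CompleteFlag

variable {n : ℕ}

theorem hasInverses_generalLinearVariety : (generalLinearVariety n).HasInverses :=
  (hasInverses_affineSpace _).induced _

theorem hasInverses_flagVariety : (flagVariety n).HasInverses :=
  hasInverses_generalLinearVariety.quotient _

theorem entry_mem_globalFunctions (i j : Fin n) :
    (fun g : GL (Fin n) ℂ => (g : Matrix (Fin n) (Fin n) ℂ) i j) ∈
      (generalLinearVariety n).globalFunctions :=
  (isMorphism_induced _ _).comp_mem_globalFunctions (coordinate_mem_globalFunctions (i, j))

/-- Stability means that `g⁻¹ T g` is lower triangular; replacing the inverse by the adjugate makes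
the equations polynomial. -/
theorem flagOfMatrix_mem_springerFiber_iff (T : (Fin n → ℂ) →ₗ[ℂ] (Fin n → ℂ))
    (g : GL (Fin n) ℂ) : flagOfMatrix n g ∈ springerFiber T ↔
      ∀ j k, k < j → ∑ b, (g : Matrix (Fin n) (Fin n) ℂ).adjugate k b *
        T ((g : Matrix (Fin n) (Fin n) ℂ).col j) b = 0 := by
  rw [(isAdapted_flagOfMatrix g).mem_springerFiber_iff]
  refine forall_congr' fun j => ?_
  have hdet : (g : Matrix (Fin n) (Fin n) ℂ).det ≠ 0 := by
    simpa using (g.isUnit.map Matrix.detMonoidHom).ne_zero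
  set x := T ((g : Matrix (Fin n) (Fin n) ℂ).col j)
  have hsum : ∀ c : Fin n → ℂ, ∑ k, c k • (g : Matrix (Fin n) (Fin n) ℂ).col k =
      (g : Matrix (Fin n) (Fin n) ℂ).mulVec c := by
    intro c
    ext b
    simp [Matrix.mulVec, dotProduct, mul_comm]
  rw [isAdapted_flagOfMatrix g j, mem_span_image_Ici_iff]
  constructor
  · rintro ⟨c, hc, hx⟩ k hk
    change (g : Matrix (Fin n) (Fin n) ℂ).adjugate.mulVec x k = 0
    rw [← hx, hsum, Matrix.mulVec_mulVec, Matrix.adjugate_mul, Matrix.smul_mulVec,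
      Matrix.one_mulVec, Pi.smul_apply, hc k hk, smul_zero]
  · intro h
    refine ⟨(g : Matrix (Fin n) (Fin n) ℂ).det⁻¹ •
      (g : Matrix (Fin n) (Fin n) ℂ).adjugate.mulVec x, fun k hk => ?_, ?_⟩
    · have := h k hk
      change (g : Matrix (Fin n) (Fin n) ℂ).adjugate.mulVec x k = 0 at this
      rw [Pi.smul_apply, this, smul_zero]
    · rw [hsum, Matrix.mulVec_smul, Matrix.mulVec_mulVec, Matrix.mul_adjugate,
        Matrix.smul_mulVec, Matrix.one_mulVec, smul_smul, inv_mul_cancel₀ hdet, one_smul]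

theorem linearMap_apply_mem {Y : Type} (A : Subalgebra ℂ (Y → ℂ))
    (T : (Fin n → ℂ) →ₗ[ℂ] (Fin n → ℂ)) {f : Y → Fin n → ℂ} (hf : ∀ b, (fun y => f y b) ∈ A)
    (b : Fin n) : (fun y => T (f y) b) ∈ A := by
  have h : ∀ y, T (f y) b = ∑ a, T (Pi.single a 1) b * f y a := by
    intro y
    rw [← congrFun (LinearMap.toMatrix'_mulVec T (f y)) b]
    simp [Matrix.mulVec, dotProduct, LinearMap.toMatrix'_apply]
  simp only [h]
  exact A.sum_fun_mem _ fun a _ => A.mul_mem (x := fun _ => _) (A.algebraMap_mem _) (hf a)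

theorem isClosed_springerFiber (T : (Fin n → ℂ) →ₗ[ℂ] (Fin n → ℂ)) :
    IsClosed[(flagVariety n).top] (springerFiber T) := by
  let _ := (generalLinearVariety n).top
  refine isClosed_coinduced.2 ?_
  have h : flagOfMatrix n ⁻¹' springerFiber T = ⋂ j, ⋂ k, ⋂ (_ : k < j),
      {g : GL (Fin n) ℂ | ∑ b, (g : Matrix (Fin n) (Fin n) ℂ).adjugate k b *
        T ((g : Matrix (Fin n) (Fin n) ℂ).col j) b = 0} := by
    ext g
    simp only [Set.mem_preimage, Set.mem_iInter]
    exact flagOfMatrix_mem_springerFiber_iff T g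
  rw [h]
  refine isClosed_iInter fun j => isClosed_iInter fun k => isClosed_iInter fun _ =>
    hasInverses_generalLinearVariety.isClosed_eq_zero ?_
  refine Subalgebra.sum_fun_mem _ _ fun b _ => Subalgebra.mul_mem _ ?_ ?_
  · exact Subalgebra.adjugate_mem _ entry_mem_globalFunctions k b
  · exact linearMap_apply_mem _ T (fun b => entry_mem_globalFunctions b j) b

theorem chartMatrix_mem_globalFunctions (w : Equiv.Perm (Fin n)) (i k j : Fin n) :
    (fun g : GL (Fin n) ℂ => chartMatrix w (g : Matrix (Fin n) (Fin n) ℂ).col i k j) ∈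
      (generalLinearVariety n).globalFunctions := by
  simp only [chartMatrix, Matrix.of_apply]
  split_ifs
  · exact Subalgebra.one_mem _
  · exact Subalgebra.zero_mem _
  · exact entry_mem_globalFunctions _ _

theorem flagOfMatrix_mem_chart_iff (w : Equiv.Perm (Fin n)) (g : GL (Fin n) ℂ) :
    flagOfMatrix n g ∈ chart w ↔
      ∀ i, (chartMatrix w (g : Matrix (Fin n) (Fin n) ℂ).col i).det ≠ 0 :=
  (isAdapted_flagOfMatrix g).mem_chart_iff (Matrix.linearIndependent_cols_of_isUnit g.isUnit)

theorem isOpen_chart (w : Equiv.Perm (Fin n)) : IsOpen[(flagVariety n).top] (chart w) := by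
  let _ := (generalLinearVariety n).top
  refine isOpen_coinduced.2 ?_
  have h : flagOfMatrix n ⁻¹' chart w =
      ⋂ i, {g : GL (Fin n) ℂ |
        (chartMatrix w (g : Matrix (Fin n) (Fin n) ℂ).col i).det ≠ 0} := by
    ext g
    simp only [Set.mem_preimage, Set.mem_iInter]
    exact flagOfMatrix_mem_chart_iff w g
  rw [h]
  exact isOpen_iInter_of_finite fun i => hasInverses_generalLinearVariety.isOpen_ne_zero
    (Subalgebra.det_mem _ (chartMatrix_mem_globalFunctions w i))

open Classical in
/-- The coordinates of a flag in the chart of `w`: its adapted reduced basis. -/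
noncomputable def chartBasis (w : Equiv.Perm (Fin n)) (F : CompleteFlag n) : Fin n → Fin n → ℂ :=
  if h : F ∈ chart w then h.choose else 0

theorem chartBasis_eq {w : Equiv.Perm (Fin n)} {F : CompleteFlag n} {u : Fin n → Fin n → ℂ}
    (hF : F.IsAdapted u) (hu : PivotReduced w u) : chartBasis w F = u := by
  have h : F ∈ chart w := ⟨u, hF, hu⟩
  rw [chartBasis, dif_pos h]
  exact h.choose_spec.1.unique h.choose_spec.2 hF hu

/-- Pulled back to `GL_n`, the coordinate is the Cramer quotient `reducedVector` of the columns. -/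
theorem isRegular_chartBasis (w : Equiv.Perm (Fin n)) (j b : Fin n) :
    (flagVariety n).IsRegular (chart w) fun F => chartBasis w F j b := by
  have ho : IsOpen[(generalLinearVariety n).top] (flagOfMatrix n ⁻¹' chart w) := isOpen_chart w
  have hdet := Subalgebra.det_mem _ (chartMatrix_mem_globalFunctions w j)
  have hnum : (fun g : GL (Fin n) ℂ => ∑ k, (chartMatrix w
      (g : Matrix (Fin n) (Fin n) ℂ).col j).adjugate k j * (g : Matrix (Fin n) (Fin n) ℂ).col k b) ∈
      (generalLinearVariety n).globalFunctions :=
    Subalgebra.sum_fun_mem _ _ fun k _ => Subalgebra.mul_mem _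
      (Subalgebra.adjugate_mem _ (chartMatrix_mem_globalFunctions w j) k j)
      (entry_mem_globalFunctions b k)
  refine (generalLinearVariety n).congr ho (f := fun g =>
    reducedVector w (g : Matrix (Fin n) (Fin n) ℂ).col j b) (fun g hg => ?_) ?_
  · obtain ⟨h1, h2⟩ := (isAdapted_flagOfMatrix g).reducedVector
      ((flagOfMatrix_mem_chart_iff w g).1 hg)
    simp only [Function.comp_apply, chartBasis_eq h1 h2]
  · exact (generalLinearVariety n).mono (hasInverses_generalLinearVariety.isOpen_ne_zero hdet) ho
      (fun g hg => (flagOfMatrix_mem_chart_iff w g).1 hg j)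
      (hasInverses_generalLinearVariety.isRegular_div hnum hdet)

/-- The flag spanned by a family of bases with regular entries depends regularly on the
parameter. -/
theorem isMorphism_flagOfMatrix_glOfColumns {Y : Type} {S : SpaceWithFunctions Y}
    (hS : S.HasInverses) {u : Y → Fin n → Fin n → ℂ} (hu : ∀ y, LinearIndependent ℂ (u y))
    (hreg : ∀ j b, (fun y => u y j b) ∈ S.globalFunctions) :
    S.IsMorphism (flagVariety n) fun y => flagOfMatrix n (glOfColumns (u y) (hu y)) :=
  (isMorphism_quotient (generalLinearVariety n) (flagOfMatrix n)).comp
    (φ := fun y => glOfColumns (u y) (hu y))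
    (IsMorphism.codRestrict (hS.isMorphism_affineSpace fun p => hreg p.2 p.1))

open Classical in
-- `φ` builds a flag from its free entries, and `ψ` reads them off the reduced basis. `φ` is a
-- morphism because it lifts to `GL_n`, and `ψ` because the cell lies in the chart.
theorem springerCell_isIsomorphic {m : ℕ} (hm : 0 < m) {w : Equiv.Perm (Fin n)}
    (hw : IsRestricted m w) :
    ((springerVariety (shiftOperator n m)).induced
      (Subtype.val : springerCell (shiftOperator n m) w → _)).IsIsomorphic
      (affineSpace (Fin (inversionsBelow m w⁻¹))) := by
  have hcard : Fintype.card {p // IsFreePair m w p} = inversionsBelow m w⁻¹ := by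
    rw [Fintype.card_subtype, card_isFreePair hm hw]
  let e := (Fintype.equivFinOfCardEq hcard).symm
  set σ := Fin (inversionsBelow m w⁻¹)
  let a : Fin n × Fin n → (σ → ℂ) → ℂ := fun p y =>
    if h : IsFreePair m w p then y (e.symm ⟨p, h⟩) else 0
  have ha : ∀ p, a p ∈ (affineSpace σ).globalFunctions := by
    intro p
    simp only [a]
    split_ifs with h
    · exact coordinate_mem_globalFunctions _
    · exact Subalgebra.zero_mem _
  obtain ⟨u, hreg, hu⟩ := exists_parametrization hw _ a ha
  have hli : ∀ y, LinearIndependent ℂ (u y) := fun y => (hu y).1.linearIndependent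
  have had := fun y => isAdapted_glOfColumns (hli y)
  let φ : (σ → ℂ) → springerCell (shiftOperator n m) w := fun y =>
    ⟨⟨flagOfMatrix n (glOfColumns (u y) (hli y)), ((had y).mem_springerFiber_iff _).2 fun j => by
      rw [had y j]
      exact (hu y).2.2.1 j⟩, mem_schubertCell_iff.2 ⟨u y, had y, (hu y).1⟩⟩
  let ψ : springerCell (shiftOperator n m) w → σ → ℂ := fun z s =>
    chartBasis w z.1.1 (w⁻¹ (e s).1.1) (e s).1.2
  have hψφ : ∀ y, ψ (φ y) = y := by
    intro y
    funext s
    have h1 : chartBasis w (φ y).1.1 = u y := chartBasis_eq (had y) (hu y).2.1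
    simp only [ψ, h1]
    rw [(hu y).2.2.2 _ (e s).2]
    simp only [a]
    rw [dif_pos (e s).2]
    simp
  have hφψ : ∀ z, φ (ψ z) = z := by
    intro z
    obtain ⟨v, hv, hve, hvr⟩ := exists_echelon_of_mem_schubertCell z.2
    have h : u (ψ z) = v := by
      refine eq_of_free_coordinates hm (had (ψ z)) (hu _).1 (hu _).2.1 hv hve hvr
        (φ (ψ z)).1.2 z.1.2 fun p hp => ?_
      rw [(hu _).2.2.2 p hp]
      simp only [a]
      rw [dif_pos hp]
      simp only [ψ, chartBasis_eq hv hvr, Equiv.apply_symm_apply]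
    refine Subtype.ext (Subtype.ext ((had (ψ z)).eq ?_))
    rwa [h]
  refine ⟨⟨ψ, φ, hφψ, hψφ⟩, ?_, ?_⟩
  · refine HasInverses.isMorphism_affineSpace
      ((hasInverses_flagVariety.induced _).induced _) fun s => ?_
    have h := ((isMorphism_induced (flagVariety n) Subtype.val).comp
      (isMorphism_induced (springerVariety (shiftOperator n m))
        (Subtype.val : springerCell (shiftOperator n m) w → _))).2 _ _ (isOpen_chart w)
        (isRegular_chartBasis w (w⁻¹ (e s).1.1) (e s).1.2)
    have huniv : (Subtype.val ∘ (Subtype.val : springerCell (shiftOperator n m) w → _)) ⁻¹'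
        chart w = Set.univ :=
      Set.eq_univ_of_forall fun z => schubertCell_subset_chart w z.2
    rw [huniv] at h
    exact h
  · exact IsMorphism.codRestrict (IsMorphism.codRestrict
      (isMorphism_flagOfMatrix_glOfColumns (hasInverses_affineSpace σ) hli hreg))

/-- In an order in which `cellHeight` decreases, the initial unions of cells are closed. -/
theorem isClosed_iUnion_springerCell {m : ℕ} (hm : 0 < m) {N : ℕ}
    (e : Fin N ≃ {w : Equiv.Perm (Fin n) // IsRestricted m w})
    (he : Antitone fun j => cellHeight (e j).1) (k : Fin N) :
    IsClosed[(springerVariety (shiftOperator n m)).top]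
      (⋃ j ≤ k, springerCell (shiftOperator n m) (e j).1) := by
  let _ := (springerVariety (shiftOperator n m)).top
  -- A flag of a later cell lies in the chart of that cell, while a later chart meeting an earlier
  -- cell would violate the order of heights.
  have h : (⋃ j ≤ k, springerCell (shiftOperator n m) (e j).1)ᶜ =
      ⋃ j, ⋃ (_ : k < j), Subtype.val ⁻¹' chart (e j).1 := by
    ext F
    simp only [Set.mem_compl_iff, Set.mem_iUnion, not_exists, Set.mem_preimage]
    obtain ⟨w, hw⟩ := F.1.exists_mem_schubertCell
    obtain ⟨j, hj⟩ := e.surjective ⟨w, isRestricted_of_mem hm F.2 hw⟩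
    have hjF : F.1 ∈ schubertCell (e j).1 := by rwa [hj]
    constructor
    · exact fun hF => ⟨j, not_le.1 fun hjk => hF j hjk hjF, schubertCell_subset_chart _ hjF⟩
    · rintro ⟨i, hki, hi⟩ l hlk hl
      have hlj : (e l).1 = (e j).1 := schubertCell_unique hl hjF
      have hne : (e l).1 ≠ (e i).1 := fun heq =>
        (hlk.trans_lt hki).ne (e.injective (Subtype.ext heq))
      exact absurd (cellHeight_lt hl hi hne) (not_lt.2 (he (hlk.trans hki.le)))
  rw [← isOpen_compl_iff, h]
  exact isOpen_iUnion fun j => isOpen_iUnion fun _ => ⟨_, isOpen_chart (e j).1, rfl⟩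

end Geometry

/-! ### Assembling the paving. -/

theorem mainTheorem11 (n m : ℕ) (hm : 0 < m) :
    IsClosed[(flagVariety n).top] (springerFiber (shiftOperator n m)) ∧
      IsAffinePaving (springerVariety (shiftOperator n m))
        (fun w : {w : Equiv.Perm (Fin n) // IsRestricted m w} =>
          springerCell (shiftOperator n m) (w : Equiv.Perm (Fin n)))
        (fun w => inversionsBelow m (w : Equiv.Perm (Fin n))⁻¹) := by
  have hdisj : Pairwise fun i j : {w : Equiv.Perm (Fin n) // IsRestricted m w} =>
      Disjoint (springerCell (shiftOperator n m) i.1) (springerCell (shiftOperator n m) j.1) :=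
    fun i j hij => Set.disjoint_left.2 fun F hi hj =>
      hij (Subtype.ext (CompleteFlag.schubertCell_unique hi hj))
  obtain ⟨e, he⟩ : ∃ e : Fin (Fintype.card {w : Equiv.Perm (Fin n) // IsRestricted m w}) ≃
      {w : Equiv.Perm (Fin n) // IsRestricted m w},
      Antitone fun j => CompleteFlag.cellHeight (e j).1 := by
    let e₀ := (Fintype.equivFin {w : Equiv.Perm (Fin n) // IsRestricted m w}).symm
    -- Sorting in the order dual lists the heights in decreasing order.
    let f := fun j => OrderDual.toDual (CompleteFlag.cellHeight (e₀ j).1)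
    exact ⟨(Tuple.sort f).trans e₀, fun i j hij => Tuple.monotone_sort f hij⟩
  have hclosed := isClosed_iUnion_springerCell hm e he
  refine ⟨isClosed_springerFiber _, ⟨fun w => ?_, hdisj, ?_, ⟨e, hclosed⟩,
    fun w => springerCell_isIsomorphic hm w.2⟩⟩
  · let _ := (springerVariety (shiftOperator n m)).top
    obtain ⟨k, rfl⟩ := e.surjective w
    have hlt : IsClosed (⋃ j < k, springerCell (shiftOperator n m) (e j).1) := by
      have : (⋃ j < k, springerCell (shiftOperator n m) (e j).1) =
          ⋃ i, ⋃ (_ : i < k), ⋃ j ≤ i, springerCell (shiftOperator n m) (e j).1 := by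
        ext F
        simp only [Set.mem_iUnion]
        exact ⟨fun ⟨j, hj, hF⟩ => ⟨j, hj, j, le_rfl, hF⟩,
          fun ⟨i, hi, j, hj, hF⟩ => ⟨j, hj.trans_lt hi, hF⟩⟩
      rw [this]
      exact isClosed_iUnion_of_finite fun i => isClosed_iUnion_of_finite fun _ => hclosed i
    -- Each cell is a difference of two closed initial unions, hence locally closed.
    have hcell : springerCell (shiftOperator n m) (e k).1 =
        (⋃ j < k, springerCell (shiftOperator n m) (e j).1)ᶜ ∩
          ⋃ j ≤ k, springerCell (shiftOperator n m) (e j).1 := by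
      ext F
      simp only [Set.mem_inter_iff, Set.mem_compl_iff, Set.mem_iUnion, not_exists]
      constructor
      · refine fun hF => ⟨fun j hj hF' => ?_, k, le_rfl, hF⟩
        exact Set.disjoint_left.1 (hdisj fun h => hj.ne (e.injective h)) hF' hF
      · rintro ⟨h1, j, hj, hF⟩
        rcases hj.eq_or_lt with rfl | hj
        · exact hF
        · exact absurd hF (h1 j hj)
    simp only [hcell]
    exact hlt.isOpen_compl.isLocallyClosed.inter (hclosed k).isLocallyClosed
  · refine Set.eq_univ_of_forall fun F => Set.mem_iUnion.2 ?_
    obtain ⟨w, hw⟩ := F.1.exists_mem_schubertCell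
    exact ⟨⟨w, isRestricted_of_mem hm F.2 hw⟩, hw⟩
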